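/- Fix an integer $r\ge 0$. Inputs are rational matrices $M\in\mathbb{Q}^{p\times q}$ of rank $r$ (with $p,q$ arbitrary), presented by writing down their entries as reduced fractions in binary. Each of the following four properties of $M$ can be decided in polynomial time, i.e. by a Turing machine (which may depend on $r$) whose running time on every such input is bounded by a polynomial (which may depend on $r$) in the encoding length of $M$: 1. $M$ satisfies the row cone generating condition (RCGC): $\mathbb{R}_+^p\cdot M=(\mathbb{R}^p\cdot M)\cap\mathbb{R}_+^q$, that is, the cone generated by the rows of $M$ is the nonnegative part of the row span of $M$; 2. $M$ satisfies the column cone generating condition (CCGC): $M\cdot\mathbb{R}_+^q=(M\cdot\mathbb{R}^q)\cap\mathbb{R}_+^p$; 3. $M$ is a slack matrix of a polyhedral cone: there are $n\ge 0$, $A\in\mathbb{R}^{p\times n}$ and $B\in\mathbb{R}^{n\times q}$ with $\{x\in\mathbb{R}^n : x^TB\ge 0\}=\mathbb{R}_+^p\cdot A$ and $M=AB$; 4. $M$ is a slack matrix of a polytope of dimension at least one: there are $n\ge 0$, $V\in\mathbb{R}^{p\times n}$, $W\in\mathbb{R}^{q\times n}$ and $w\in\mathbb{R}^q$ such that the convex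 hull $P$ of the rows of $V$ equals $\{x\in\mathbb{R}^n : Wx\le w\}$, $\dim P\ge 1$, and $M=[\mathbb{1},V]\cdot[w,-W]^T$. -/

import Mathlib

namespace SlackMatrix

open Matrix Computability

/-! ### Cone generating conditions and slack matrices (over the reals) -/

/-- Row cone generating condition: `ℝ₊ᵖ · M = (ℝᵖ · M) ∩ ℝ₊^q`. -/
def RCGC {p q : ℕ} (M : Matrix (Fin p) (Fin q) ℝ) : Prop :=
  {x : Fin q → ℝ | ∃ y : Fin p → ℝ, 0 ≤ y ∧ y ᵥ* M = x} =
    {x : Fin q → ℝ | ∃ y : Fin p → ℝ, y ᵥ* M = x} ∩ {x : Fin q → ℝ | 0 ≤ x}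

/-- Column cone generating condition: `M · ℝ₊^q = (M · ℝ^q) ∩ ℝ₊ᵖ`. -/
def CCGC {p q : ℕ} (M : Matrix (Fin p) (Fin q) ℝ) : Prop :=
  {x : Fin p → ℝ | ∃ y : Fin q → ℝ, 0 ≤ y ∧ M *ᵥ y = x} =
    {x : Fin p → ℝ | ∃ y : Fin q → ℝ, M *ᵥ y = x} ∩ {x : Fin p → ℝ | 0 ≤ x}

/-- `M` is a slack matrix of a polyhedral cone: `M = A B`, where for some `n` the polyhedral cone
`K = {x ∈ ℝⁿ | xᵀ B ≥ 0}` is generated by the rows of `A`. -/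
def IsConeSlackMatrix {p q : ℕ} (M : Matrix (Fin p) (Fin q) ℝ) : Prop :=
  ∃ (n : ℕ) (A : Matrix (Fin p) (Fin n) ℝ) (B : Matrix (Fin n) (Fin q) ℝ),
    {x : Fin n → ℝ | 0 ≤ x ᵥ* B} = {x : Fin n → ℝ | ∃ y : Fin p → ℝ, 0 ≤ y ∧ y ᵥ* A = x} ∧
      M = A * B

/-- `M` is a slack matrix of a polytope of dimension at least one: for some `n` there is a polytope
`P = conv (rows V) = {x ∈ ℝⁿ | W x ≤ w}` with `dim P ≥ 1` such that `M = [𝟙, V] · [w, -W]ᵀ`,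
i.e. the `(i, j)` entry of `M` is the slack `w j - ⟨W j, V i⟩` of the `i`-th point in the
`j`-th inequality. -/
def IsPolytopeSlackMatrix {p q : ℕ} (M : Matrix (Fin p) (Fin q) ℝ) : Prop :=
  ∃ (n : ℕ) (V : Matrix (Fin p) (Fin n) ℝ) (W : Matrix (Fin q) (Fin n) ℝ) (w : Fin q → ℝ),
    convexHull ℝ (Set.range V.row) = {x : Fin n → ℝ | W *ᵥ x ≤ w} ∧
      1 ≤ Module.finrank ℝ (vectorSpan ℝ (convexHull ℝ (Set.range V.row))) ∧
      M = Matrix.of fun i j => w j - W j ⬝ᵥ V i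

/-! ### Inputs: rational matrices of a given rank, and their binary encoding -/

/-- The rational matrices (of any size) of rank `r`. -/
structure RankMatrix (r : ℕ) where
  /-- number of rows -/
  p : ℕ
  /-- number of columns -/
  q : ℕ
  /-- the matrix -/
  mat : Matrix (Fin p) (Fin q) ℚ
  rank_eq : mat.rank = r

/-- The input matrix, regarded as a real matrix. -/
noncomputable def RankMatrix.toReal {r : ℕ} (M : RankMatrix r) :
    Matrix (Fin M.p) (Fin M.q) ℝ :=
  M.mat.map fun x : ℚ => (x : ℝ)

/-- Binary notation of a natural number. -/
def natCode (n : ℕ) : List Γ' := (encodeNat n).map Γ'.bit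

/-- A rational number in lowest terms: sign bit, numerator in binary, denominator in binary. -/
def ratCode (x : ℚ) : List Γ' :=
  Γ'.bit (decide (x < 0)) :: (natCode x.num.natAbs ++ Γ'.comma :: (natCode x.den ++ [Γ'.comma]))

/-- A row of a matrix: its entries, one after the other, between brackets. -/
def rowCode {q : ℕ} (v : Fin q → ℚ) : List Γ' :=
  Γ'.bra :: ((List.ofFn fun j => ratCode (v j)).flatten ++ [Γ'.ket])

/-- A rational matrix: its dimensions `p`, `q` in unary, then its rows. (There are `p` rows, and
`q` entries in each, so writing the dimensions in unary does not inflate the input.) -/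
def matrixCode {p q : ℕ} (M : Matrix (Fin p) (Fin q) ℚ) : List Γ' :=
  List.replicate p (Γ'.bit true) ++ Γ'.comma ::
    (List.replicate q (Γ'.bit true) ++ Γ'.comma ::
      (List.ofFn fun i => rowCode (M i)).flatten)

/-- The input string that presents a rational matrix of rank `r`. -/
def RankMatrix.code {r : ℕ} (M : RankMatrix r) : List Γ' := matrixCode M.mat

/-! ### Polynomial time -/

/-- A yes/no question `P` about objects that are presented as strings by `code` can be decided in
polynomial time: one Turing machine answers it correctly on the code of every object, in a number
of steps bounded by a polynomial in the length of that code. -/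
def DecidableInPolyTime {α Γ : Type} (code : α → List Γ) (P : α → Prop) : Prop :=
  Nonempty (Turing.TM2ComputableInPolyTime code encodeBool
    fun a => @decide (P a) (Classical.propDecidable (P a)))

end SlackMatrix

/-!
The rank `r` is fixed, so a statement about `M` that quantifies over `O(r)` row and column indices
and whose atoms are sign conditions on minors of size at most `r + 1` can be checked by brute
force: there are polynomially many tuples of indices, and each minor is a sum of at most
`(r + 1)!` products of entries. It remains to find such descriptions and to carry out the brute
force on a Turing machine.

**The descriptions.** `M` satisfies the RCGC if and only if `M` is nonnegative and each nonnegative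
vector `x` in the row span is a nonnegative combination of rows (`rcgc_iff`). Subtracting suitable
multiples of other vectors reduces the support of `x`, until `x` spans the line of all vectors in
the row span that vanish on the zero set of `x`. Such a line is given by minors: if `M` has rank
`s + 1`, it is spanned by `j ↦ det M[I, (j, J)]` for some `s + 1` rows `I` and `s` columns `J`. So
the RCGC says that whenever this vector is nonzero and does not change sign, some nonzero row
vanishes on `J` (`rcgc_iff_minors`). The other properties are reduced to this one.
* The CCGC is the RCGC of the transpose (`ccgc_iff_rcgc_transpose`).
* Slack matrices of cones are the matrices with the RCGC (`isConeSlackMatrix_iff_rcgc`): if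
  `M = A B`, then `x ↦ x B` maps the cone onto the nonnegative part of the row span; conversely,
  any rank factorization of `M` will do.
* Slack matrices of polytopes of positive dimension are the matrices with the RCGC that have `𝟙` in
  the column span and two distinct rows (`isPolytopeSlackMatrix_iff`): the cone over the rows is the
  homogenization of the polytope. The condition on `𝟙` says that bordering `M` by `𝟙` does not
  increase the rank, which is again a condition on minors (`exists_mulVec_eq_one_iff`).

For `r = 0` the matrix is zero, and the answers are constant.

**The machine.** `Prog` is a structured language of stack programs; `Eval.steps` compiles it to the
machines `TM2` of Mathlib without loss of time. A function between types whose elements are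
presented by finitely many strings is in `FP` if such a program computes it in polynomial time.
`FP` is closed under composition, pairing, case distinction, and iteration with polynomially
bounded intermediate results (`FP.iterate`); this yields binary arithmetic, arithmetic with
fractions (`RatFP`), determinants of fixed size, and the predicates (`PolyDec`) that are obtained
from sign conditions by Boolean operations and bounded quantifiers. Fractions are not reduced:
this is harmless since only a constant number of operations is applied to the entries.
-/

open Computability Turing Matrix

namespace SlackMatrix

/-! ### A small structured language of stack programs -/

/-- Structured programs that work on a family, indexed by `K`, of stacks ("registers") of
symbols from `Γ'`. -/
inductive Prog (K : Type) : Type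
  /-- do nothing -/
  | nop : Prog K
  /-- push the symbol `a` on register `k` -/
  | push (k : K) (a : Γ') : Prog K
  /-- pop a symbol from register `k`, and push it on each of the registers in `ks`; nothing happens
  if register `k` is empty -/
  | move (k : K) (ks : List K) : Prog K
  /-- sequential execution -/
  | seq (p q : Prog K) : Prog K
  /-- execute `p` or `q`, depending on a test of the top of register `k` -/
  | ite (k : K) (t : Option Γ' → Bool) (p q : Prog K) : Prog K
  /-- execute `p` as long as register `k` is not empty -/
  | loop (k : K) (p : Prog K) : Prog K

namespace Prog

variable {K : Type} [DecidableEq K]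

/-- Push `a` on each of the registers in `ks`. -/
def pushAll (a : Γ') : List K → (K → List Γ') → K → List Γ'
  | [], s => s
  | k :: ks, s => pushAll a ks (Function.update s k (a :: s k))

/-- Big-step semantics: `Eval p s s' t` says that the program `p`, started with register contents
`s`, ends with register contents `s'` after `t` steps. -/
inductive Eval : Prog K → (K → List Γ') → (K → List Γ') → ℕ → Prop
  | nop (s) : Eval nop s s 1
  | push (k a s) : Eval (push k a) s (Function.update s k (a :: s k)) 1
  | move_nil (k ks s) (h : s k = []) : Eval (move k ks) s s 1
  | move_cons (k ks s a l) (h : s k = a :: l) :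
      Eval (move k ks) s (pushAll a ks (Function.update s k l)) 1
  | seq {p q s s' s'' t t'} (h : Eval p s s' t) (h' : Eval q s' s'' t') :
      Eval (seq p q) s s'' (t + t')
  | ite_true {k f p q s s' t} (hf : f (s k).head? = true) (h : Eval p s s' t) :
      Eval (ite k f p q) s s' (t + 1)
  | ite_false {k f p q s s' t} (hf : f (s k).head? = false) (h : Eval q s s' t) :
      Eval (ite k f p q) s s' (t + 1)
  | loop_nil {k p s} (h : s k = []) : Eval (loop k p) s s 1
  | loop_cons {k p s s' s'' t t'} (h : s k ≠ []) (h1 : Eval p s s' t)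
      (h2 : Eval (loop k p) s' s'' t') : Eval (loop k p) s s'' (t + t' + 1)

/-! ### Compilation to Turing machines with several stacks -/

/-- The labels of the compiled program. -/
def Lab : Prog K → Type
  | nop => Unit
  | push _ _ => Unit
  | move _ _ => Unit
  | seq p q => Lab p ⊕ Lab q
  | ite _ _ p q => Option (Lab p ⊕ Lab q)
  | loop _ p => Option (Lab p)

instance Lab.instFintype : (p : Prog K) → Fintype (Lab p)
  | nop => inferInstanceAs (Fintype Unit)
  | push _ _ => inferInstanceAs (Fintype Unit)
  | move _ _ => inferInstanceAs (Fintype Unit)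
  | seq p q =>
    letI := Lab.instFintype p; letI := Lab.instFintype q
    inferInstanceAs (Fintype (Lab p ⊕ Lab q))
  | ite _ _ p q =>
    letI := Lab.instFintype p; letI := Lab.instFintype q
    inferInstanceAs (Fintype (Option (Lab p ⊕ Lab q)))
  | loop _ p =>
    letI := Lab.instFintype p
    inferInstanceAs (Fintype (Option (Lab p)))

/-- The label at which the compiled program is entered. -/
def entry : (p : Prog K) → Lab p
  | nop => ()
  | push _ _ => ()
  | move _ _ => ()
  | seq p _ => Sum.inl (entry p)
  | ite _ _ _ _ => none
  | loop _ _ => none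

/-- The alphabets of the machine: `Γ'` on the registers, and `Bool` on one additional stack, which
receives the answer. -/
abbrev StackSymbol : Option K → Type
  | none => Bool
  | some _ => Γ'

/-- The statement that pushes the symbol in the internal state on the registers in `ks`, and then
does `q`. -/
def pushStmt {Λ : Type} (q : TM2.Stmt (StackSymbol (K := K)) Λ (Option Γ')) :
    List K → TM2.Stmt (StackSymbol (K := K)) Λ (Option Γ')
  | [] => q
  | k :: ks => TM2.Stmt.push (some k) (fun v => v.getD Γ'.blank) (pushStmt q ks)

/-- The statements of the compiled program. The labels of `p` are embedded by `e` into the labels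
of the whole machine, and control leaves the program through the label `x`. -/
def code {Λ : Type} : (p : Prog K) → (Lab p → Λ) → Λ → Lab p →
    TM2.Stmt (StackSymbol (K := K)) Λ (Option Γ')
  | nop, _, x, _ => .goto fun _ => x
  | push k a, _, x, _ => .push (some k) (fun _ => a) (.goto fun _ => x)
  | move k ks, _, x, _ =>
    .pop (some k) (fun _ h => h) (.branch Option.isSome (pushStmt (.goto fun _ => x) ks)
      (.goto fun _ => x))
  | seq p q, e, x, l =>
    match l with
    | .inl l => code p (fun l => e (.inl l)) (e (.inr (entry q))) l
    | .inr l => code q (fun l => e (.inr l)) x l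
  | ite k f p q, e, x, l =>
    match l with
    | none => .peek (some k) (fun _ h => h) (.branch f (.goto fun _ => e (some (.inl (entry p))))
      (.goto fun _ => e (some (.inr (entry q)))))
    | some (.inl l) => code p (fun l => e (some (.inl l))) x l
    | some (.inr l) => code q (fun l => e (some (.inr l))) x l
  | loop k p, e, x, l =>
    match l with
    | none => .peek (some k) (fun _ h => h) (.branch Option.isSome
      (.goto fun _ => e (some (entry p))) (.goto fun _ => x))
    | some l => code p (fun l => e (some l)) (e none) l

/-- The stacks of the machine, given the contents of the registers and the answer. -/
def regStacks (s : K → List Γ') (b : List Bool) : (k : Option K) → List (StackSymbol k)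
  | none => b
  | some k => s k

theorem update_regStacks (s : K → List Γ') (b : List Bool) (k : K) (l : List Γ') :
    Function.update (regStacks s b) (some k) l = regStacks (Function.update s k l) b := by
  funext k'
  rcases k' with _ | k'
  · exact Function.update_of_ne (by simp) _ _
  · by_cases h : k' = k
    · subst h
      exact (Function.update_self (some k') _ _).trans (Function.update_self k' l s).symm
    · have h1 : Function.update s k l k' = s k' := Function.update_of_ne h l s
      exact (Function.update_of_ne (by simpa using h) _ _).trans h1.symm

/-- `t` steps of the machine lead from `c` to `c'`. -/
def Steps {Λ : Type} (m : Λ → TM2.Stmt (StackSymbol (K := K)) Λ (Option Γ')) (t : ℕ)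
    (c c' : TM2.Cfg (StackSymbol (K := K)) Λ (Option Γ')) : Prop :=
  (flip bind (TM2.step m))^[t] (some c) = some c'

theorem Steps.trans {Λ : Type} {m : Λ → TM2.Stmt (StackSymbol (K := K)) Λ (Option Γ')}
    {t t' : ℕ} {c c' c''} (h : Steps m t c c') (h' : Steps m t' c' c'') :
    Steps m (t + t') c c'' := by
  unfold Steps at *
  rw [add_comm, Function.iterate_add_apply, h, h']

theorem Steps.one {Λ : Type} {m : Λ → TM2.Stmt (StackSymbol (K := K)) Λ (Option Γ')} (l : Λ)
    (v S) : Steps m 1 ⟨some l, v, S⟩ (TM2.stepAux (m l) v S) := rfl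

theorem stepAux_pushStmt {Λ : Type} (x : Λ) (a : Γ') (ks : List K) (s : K → List Γ')
    (b : List Bool) :
    TM2.stepAux (pushStmt (.goto fun _ => x) ks) (some a) (regStacks s b) =
      ⟨some x, some a, regStacks (pushAll a ks s) b⟩ := by
  induction ks generalizing s with
  | nil => rfl
  | cons k ks ih =>
    have h := update_regStacks s b k (a :: s k)
    change TM2.stepAux (pushStmt (.goto fun _ => x) ks) (some a)
      (Function.update (regStacks s b) (some k) (a :: s k)) = _
    rw [h, ih]
    rfl

/-- The compiled program simulates the program, step by step. -/
theorem Eval.steps {Λ : Type} {m : Λ → TM2.Stmt (StackSymbol (K := K)) Λ (Option Γ')}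
    {p : Prog K} {s s' : K → List Γ'} {t : ℕ} (h : Eval p s s' t) (b : List Bool) :
    ∀ (e : Lab p → Λ) (x : Λ), (∀ l, m (e l) = code p e x l) → ∀ v, ∃ v',
      Steps m t ⟨some (e (entry p)), v, regStacks s b⟩ ⟨some x, v', regStacks s' b⟩ := by
  induction h with
  | nop s =>
    intro e x hm v
    refine ⟨v, ?_⟩
    have := Steps.one (m := m) (e (entry Prog.nop)) v (regStacks s b)
    rwa [hm] at this
  | push k a s =>
    intro e x hm v
    refine ⟨v, ?_⟩
    have := Steps.one (m := m) (e (entry (Prog.push k a))) v (regStacks s b)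
    rw [hm] at this
    rw [← update_regStacks]
    exact this
  | move_nil k ks s h =>
    intro e x hm v
    refine ⟨none, ?_⟩
    have := Steps.one (m := m) (e (entry (Prog.move k ks))) v (regStacks s b)
    rw [hm] at this
    simp only [code, TM2.stepAux, List.tail] at this
    have h1 : regStacks s b (some k) = [] := h
    have h2 : Function.update (regStacks s b) (some k) [] = regStacks s b := by
      conv_rhs => rw [← Function.update_eq_self (some k) (regStacks s b)]
      rw [h1]
    rw [h1] at this
    rw [h2] at this
    exact this
  | move_cons k ks s a l h =>
    intro e x hm v
    refine ⟨some a, ?_⟩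
    have := Steps.one (m := m) (e (entry (Prog.move k ks))) v (regStacks s b)
    rw [hm] at this
    simp only [code, TM2.stepAux] at this
    have h1 : regStacks s b (some k) = a :: l := h
    rw [h1] at this
    have h2 := update_regStacks s b k l
    simp only [List.tail_cons, List.head?_cons, Option.isSome_some, cond_true] at this
    erw [h2, stepAux_pushStmt] at this
    exact this
  | @seq p q s s' s'' t t' h h' ih ih' =>
    intro e x hm v
    obtain ⟨v', h1⟩ := ih (fun l => e (.inl l)) (e (.inr (entry q))) (fun l => hm (.inl l)) v
    obtain ⟨v'', h2⟩ := ih' (fun l => e (.inr l)) x (fun l => hm (.inr l)) v'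
    exact ⟨v'', h1.trans h2⟩
  | @ite_true k f p q s s' t hf h ih =>
    intro e x hm v
    obtain ⟨v', h1⟩ := ih (fun l => e (some (.inl l))) x (fun l => hm (some (.inl l)))
      (s k).head?
    refine ⟨v', ?_⟩
    have := Steps.one (m := m) (e (entry (Prog.ite k f p q))) v (regStacks s b)
    rw [hm] at this
    simp only [entry, code, TM2.stepAux] at this
    erw [hf] at this
    rw [add_comm]
    exact this.trans h1
  | @ite_false k f p q s s' t hf h ih =>
    intro e x hm v
    obtain ⟨v', h1⟩ := ih (fun l => e (some (.inr l))) x (fun l => hm (some (.inr l)))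
      (s k).head?
    refine ⟨v', ?_⟩
    have := Steps.one (m := m) (e (entry (Prog.ite k f p q))) v (regStacks s b)
    rw [hm] at this
    simp only [entry, code, TM2.stepAux] at this
    erw [hf] at this
    rw [add_comm]
    exact this.trans h1
  | @loop_nil k p s h =>
    intro e x hm v
    refine ⟨(s k).head?, ?_⟩
    have := Steps.one (m := m) (e (entry (Prog.loop k p))) v (regStacks s b)
    rw [hm] at this
    simp only [entry, code, TM2.stepAux] at this
    have h1 : regStacks s b (some k) = [] := h
    rw [h1] at this
    rw [h]
    exact this
  | @loop_cons k p s s' s'' t t' h h1 h2 ih ih' =>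
    intro e x hm v
    obtain ⟨v', h3⟩ := ih (fun l => e (some l)) (e none) (fun l => hm (some l)) (s k).head?
    obtain ⟨v'', h4⟩ := ih' e x hm v'
    refine ⟨v'', ?_⟩
    have := Steps.one (m := m) (e (entry (Prog.loop k p))) v (regStacks s b)
    rw [hm] at this
    simp only [entry, code, TM2.stepAux] at this
    have h5 : Option.isSome (regStacks s b (some k)).head? = true := by
      change Option.isSome (s k).head? = true
      cases hk : s k with
      | nil => exact absurd hk h
      | cons a l => rfl
    erw [h5] at this
    rw [add_comm (t + t') 1]
    exact this.trans (h3.trans h4)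

end Prog

namespace Prog

/-! ### Renaming registers -/

/-- An embedding of one family of registers into another, with a partial inverse. -/
structure Emb (K K' : Type) where
  /-- the embedding -/
  toFun : K → K'
  /-- its partial inverse -/
  inv : K' → Option K
  inv_toFun : ∀ k, inv (toFun k) = some k
  eq_toFun : ∀ k k', inv k' = some k → k' = toFun k

variable {K K' : Type}

/-- Register contents on `K'`, given by `s` on the image of `e`, and by `S` elsewhere. -/
def Emb.over (e : Emb K K') (s : K → List Γ') (S : K' → List Γ') : K' → List Γ' :=
  fun k => (e.inv k).elim (S k) s

theorem Emb.over_apply (e : Emb K K') (s S k) : e.over s S (e.toFun k) = s k := by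
  simp [Emb.over, e.inv_toFun]

variable [DecidableEq K] [DecidableEq K']

theorem Emb.over_update (e : Emb K K') (s S k l) :
    e.over (Function.update s k l) S = Function.update (e.over s S) (e.toFun k) l := by
  funext k'
  by_cases h : k' = e.toFun k
  · subst h
    rw [Emb.over_apply, Function.update_self, Function.update_self]
  · rw [Function.update_of_ne h, Emb.over, Emb.over]
    cases hk : e.inv k' with
    | none => rfl
    | some k'' =>
      have h1 : k'' ≠ k := by
        rintro rfl
        exact h (e.eq_toFun _ _ hk)
      simp [h1]

/-- The same program, on renamed registers. -/
def rename (e : Emb K K') : Prog K → Prog K'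
  | nop => nop
  | push k a => push (e.toFun k) a
  | move k ks => move (e.toFun k) (ks.map e.toFun)
  | seq p q => seq (rename e p) (rename e q)
  | ite k f p q => ite (e.toFun k) f (rename e p) (rename e q)
  | loop k p => loop (e.toFun k) (rename e p)

theorem Emb.over_pushAll (e : Emb K K') (a : Γ') (ks : List K) (s S) :
    e.over (pushAll a ks s) S = pushAll a (ks.map e.toFun) (e.over s S) := by
  induction ks generalizing s with
  | nil => rfl
  | cons k ks ih => rw [pushAll, ih, List.map_cons, pushAll, e.over_update, e.over_apply]

theorem Eval.rename {p : Prog K} {s s' : K → List Γ'} {t : ℕ} (h : Eval p s s' t)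
    (e : Emb K K') (S : K' → List Γ') :
    Eval (p.rename e) (e.over s S) (e.over s' S) t := by
  induction h with
  | nop s => exact Eval.nop _
  | push k a s =>
    rw [e.over_update]
    have := Eval.push (e.toFun k) a (e.over s S)
    rwa [e.over_apply] at this
  | move_nil k ks s h =>
    exact Eval.move_nil _ _ _ (by rwa [e.over_apply])
  | move_cons k ks s a l h =>
    rw [e.over_pushAll, e.over_update]
    exact Eval.move_cons _ _ _ _ _ (by rwa [e.over_apply])
  | seq h h' ih ih' => exact Eval.seq ih ih'
  | ite_true hf h ih => exact Eval.ite_true (by rwa [e.over_apply]) ih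
  | ite_false hf h ih => exact Eval.ite_false (by rwa [e.over_apply]) ih
  | loop_nil h => exact Eval.loop_nil (by rwa [e.over_apply])
  | loop_cons h h1 h2 ih ih' => exact Eval.loop_cons (by rwa [e.over_apply]) ih ih'

theorem Eval.cast {p : Prog K} {s s' s'' : K → List Γ'} {t t' : ℕ} (h : Eval p s s' t)
    (hs : s' = s'') (ht : t = t') : Eval p s s'' t' := hs ▸ ht ▸ h

/-! ### Clearing, copying and moving registers -/

/-- Empty the register `k`. -/
def clear (k : K) : Prog K := loop k (move k [])

theorem eval_clear (k : K) (s : K → List Γ') :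
    Eval (clear k) s (Function.update s k []) (2 * (s k).length + 1) := by
  generalize hl : s k = l
  induction l generalizing s with
  | nil =>
    have : Function.update s k [] = s := by rw [← hl, Function.update_eq_self]
    rw [this]
    exact Eval.loop_nil hl
  | cons a l ih =>
    have h := ih (Function.update s k l) (by simp)
    rw [Function.update_idem] at h
    have := Eval.loop_cons (by simp [hl]) (Eval.move_cons k [] s a l hl) h
    exact this.cast rfl (by simp; ring)

/-- Pop all symbols from `k`, and push them on `k'`. -/
theorem eval_transfer {k k' : K} (hk : k ≠ k') (s : K → List Γ') :
    Eval (loop k (move k [k'])) s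
      (Function.update (Function.update s k []) k' ((s k).reverse ++ s k'))
      (2 * (s k).length + 1) := by
  generalize hl : s k = l
  induction l generalizing s with
  | nil =>
    have : Function.update s k [] = s := by rw [← hl, Function.update_eq_self]
    simp only [this, List.reverse_nil, List.nil_append, Function.update_eq_self]
    exact Eval.loop_nil hl
  | cons a l ih =>
    have h1 := Eval.move_cons k [k'] s a l hl
    simp only [pushAll, Function.update_of_ne hk.symm] at h1
    have h := ih (Function.update (Function.update s k l) k' (a :: s k'))
      (by simp [Function.update_of_ne hk])
    refine (Eval.loop_cons (by simp [hl]) h1 h).cast ?_ (by simp; ring)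
    funext x
    by_cases hx' : x = k'
    · subst hx'; simp
    by_cases hx : x = k
    · subst hx; simp [hx']
    · simp [hx, hx']

/-- Pop all symbols from `k`, and push them on both `k'` and `k''`. -/
theorem eval_transfer₂ {k k' k'' : K} (hk : k ≠ k') (hk' : k ≠ k'') (hkk : k' ≠ k'')
    (s : K → List Γ') :
    Eval (loop k (move k [k', k''])) s
      (Function.update (Function.update (Function.update s k []) k' ((s k).reverse ++ s k')) k''
        ((s k).reverse ++ s k''))
      (2 * (s k).length + 1) := by
  generalize hl : s k = l
  induction l generalizing s with
  | nil =>
    have : Function.update s k [] = s := by rw [← hl, Function.update_eq_self]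
    simp only [this, List.reverse_nil, List.nil_append, Function.update_eq_self]
    exact Eval.loop_nil hl
  | cons a l ih =>
    have h1 := Eval.move_cons k [k', k''] s a l hl
    simp only [pushAll, Function.update_of_ne hk.symm, Function.update_of_ne hk'.symm,
      Function.update_of_ne hkk.symm] at h1
    have h := ih (Function.update (Function.update (Function.update s k l) k' (a :: s k')) k''
      (a :: s k'')) (by simp [Function.update_of_ne hk, Function.update_of_ne hk'])
    refine (Eval.loop_cons (by simp [hl]) h1 h).cast ?_ (by simp; ring)
    funext x
    by_cases hx'' : x = k''
    · subst hx''; simp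
    by_cases hx' : x = k'
    · subst hx'; simp [hx'']
    by_cases hx : x = k
    · subst hx; simp [hx', hx'']
    · simp [hx, hx', hx'']

/-- Move the contents of `k` to `k'`, using `tmp` as intermediate storage. -/
def shift (k k' tmp : K) : Prog K := seq (loop k (move k [tmp])) (loop tmp (move tmp [k']))

theorem eval_shift {k k' tmp : K} (hk : k ≠ k') (ht : k ≠ tmp) (ht' : k' ≠ tmp)
    (s : K → List Γ') (htmp : s tmp = []) (hs : s k' = []) :
    Eval (shift k k' tmp) s (Function.update (Function.update s k []) k' (s k))
      (4 * (s k).length + 2) := by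
  have h1 := eval_transfer ht s
  rw [htmp, List.append_nil] at h1
  have h2 := eval_transfer ht'.symm
    (Function.update (Function.update s k []) tmp (s k).reverse)
  rw [Function.update_self, Function.update_idem, Function.update_of_ne ht',
    Function.update_of_ne hk.symm, hs, List.append_nil, List.reverse_reverse] at h2
  refine (Eval.seq h1 h2).cast ?_ (by simp; ring)
  funext x
  by_cases hx' : x = k'
  · subst hx'; simp
  by_cases hx : x = tmp
  · subst hx; simp [hx', htmp, ht.symm]
  · simp [hx, hx']

/-- Copy the contents of `k` to `k'`, using `tmp` as intermediate storage. -/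
def copy (k k' tmp : K) : Prog K := seq (loop k (move k [tmp])) (loop tmp (move tmp [k, k']))

theorem eval_copy {k k' tmp : K} (hk : k ≠ k') (ht : k ≠ tmp) (ht' : k' ≠ tmp)
    (s : K → List Γ') (htmp : s tmp = []) (hs : s k' = []) :
    Eval (copy k k' tmp) s (Function.update s k' (s k)) (4 * (s k).length + 2) := by
  have h1 := eval_transfer ht s
  rw [htmp, List.append_nil] at h1
  have h2 := eval_transfer₂ ht.symm ht'.symm hk
    (Function.update (Function.update s k []) tmp (s k).reverse)
  rw [Function.update_self, Function.update_idem, Function.update_of_ne ht',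
    Function.update_of_ne hk.symm, hs, List.append_nil, List.reverse_reverse,
    Function.update_of_ne ht, Function.update_self, List.append_nil] at h2
  refine (Eval.seq h1 h2).cast ?_ (by simp; ring)
  funext x
  by_cases hx' : x = k'
  · subst hx'; simp
  by_cases hx : x = tmp
  · subst hx; simp [hx', htmp, ht.symm]
  by_cases hxk : x = k
  · subst hxk; simp [hx']
  · simp [hx, hx', hxk]

/-- Execute `p j` for every `j` in the list. -/
def forEach {J : Type} (p : J → Prog K) : List J → Prog K
  | [] => nop
  | j :: l => seq (p j) (forEach p l)

/-- Execute `p j` for every `j : J`, in some order. -/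
noncomputable def forAll {J : Type} [Fintype J] (p : J → Prog K) : Prog K :=
  forEach p Finset.univ.toList

/-- If `p j` turns the `j`-th component of the state from `x j` to `x' j`, then all `p j` together
turn `x` into `x'`. -/
theorem eval_forAll {J X : Type} [Fintype J] [DecidableEq J] (p : J → Prog K)
    (S : (J → X) → K → List Γ') (x x' : J → X) (c : ℕ)
    (h : ∀ (y : J → X) (j : J), (∀ i, y i = x i ∨ y i = x' i) → y j = x j →
      ∃ t ≤ c, Eval (p j) (S y) (S (Function.update y j (x' j))) t) :
    ∃ t ≤ Fintype.card J * c + 1, Eval (forAll p) (S x) (S x') t := by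
  have key : ∀ (l : List J) (T : Finset J), l.Nodup → (∀ j ∈ l, j ∉ T) → (∀ j, j ∈ T ∨ j ∈ l) →
      ∃ t ≤ l.length * c + 1, Eval (forEach p l) (S (T.piecewise x' x)) (S x') t := by
    intro l
    induction l with
    | nil =>
      intro T _ _ h2
      refine ⟨1, by simp, ?_⟩
      have : T.piecewise x' x = x' := by
        funext j
        have := h2 j
        simp at this
        simp [this]
      rw [this]
      exact Eval.nop _
    | cons j l ih =>
      intro T h0 h1 h2
      rw [List.nodup_cons] at h0
      obtain ⟨t, ht, he⟩ := h (T.piecewise x' x) j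
        (fun i => by by_cases hi : i ∈ T <;> simp [hi]) (by simp [h1 j (by simp)])
      obtain ⟨t', ht', he'⟩ := ih (insert j T) h0.2
        (fun i hi => by
          simp only [Finset.mem_insert, not_or]
          exact ⟨fun h => h0.1 (h ▸ hi), h1 i (by simp [hi])⟩)
        (fun i => by
          have := h2 i
          simp only [List.mem_cons] at this
          simp only [Finset.mem_insert]
          tauto)
      refine ⟨t + t', ?_, ?_⟩
      · simp only [List.length_cons]; linarith
      · rw [← Finset.piecewise_insert] at he
        exact Eval.seq he he'
  obtain ⟨t, ht, he⟩ := key Finset.univ.toList ∅ (Finset.nodup_toList _) (by simp) (by simp)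
  rw [Finset.length_toList] at ht
  rw [Finset.piecewise_empty] at he
  exact ⟨t, ht, he⟩

end Prog

section PolynomialTime

open Prog

/-! ### Polynomial-time functions -/

/-- A type whose elements are presented by a fixed finite number of strings over `Γ'`. -/
class Presented (α : Type) where
  /-- the index type of the strings that present an element -/
  ι : Type
  [fintype : Fintype ι]
  [decidableEq : DecidableEq ι]
  /-- the strings that present an element -/
  enc : α → ι → List Γ'

attribute [reducible, instance] Presented.fintype Presented.decidableEq

open Presented

/-- The total length of the strings that present `a`. -/
def size {α : Type} [Presented α] (a : α) : ℕ := ∑ i, (enc a i).length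

instance : Presented (List Γ') where
  ι := Unit
  enc l _ := l

/-- A symbol is presented by the string of length one. -/
instance : Presented Γ' where
  ι := Unit
  enc a _ := [a]

/-- The integers that are used as indices and as counters are presented in unary. -/
instance : Presented ℕ where
  ι := Unit
  enc n _ := List.replicate n (Γ'.bit true)

/-- Truth is a test for emptiness, which a program can make without changing the string. -/
instance : Presented Bool where
  ι := Unit
  enc b _ := if b then [Γ'.bit true] else []

instance {α β : Type} [Presented α] [Presented β] : Presented (α × β) where
  ι := ι α ⊕ ι β
  enc x := Sum.elim (enc x.1) (enc x.2)

instance {α : Type} [Presented α] (n : ℕ) : Presented (Fin n → α) where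
  ι := Fin n × ι α
  enc x i := enc (x i.1) i.2

theorem size_list (l : List Γ') : size l = l.length := by
  simp [size, enc, ι]

theorem size_symbol (a : Γ') : size a = 1 := by
  simp [size, enc, ι]

theorem size_nat (n : ℕ) : size n = n := by
  simp [size, enc, ι]

theorem size_bool (b : Bool) : size b ≤ 1 := by
  cases b <;> simp [size, enc, ι]

theorem size_prod {α β : Type} [Presented α] [Presented β] (x : α × β) :
    size x = size x.1 + size x.2 :=
  Fintype.sum_sum_type _

theorem length_enc_le_size {α : Type} [Presented α] (a : α) (i : ι α) :
    (enc a i).length ≤ size a :=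
  Finset.single_le_sum (f := fun i => (enc a i).length) (fun _ _ => Nat.zero_le _)
    (Finset.mem_univ i)

/-- Register contents on input registers, output registers and scratch registers. -/
abbrev regs {I O S : Type} (x : I → List Γ') (y : O → List Γ') (z : S → List Γ') :
    I ⊕ O ⊕ S → List Γ' := Sum.elim x (Sum.elim y z)

/-- The program `p` computes `f`, within time `P`: started on the input `a` (with all other
registers empty), it writes `f a` on the output registers, restores the input, and
leaves the scratch registers empty. The value `f a` has size at most `P`, too. -/
def Computes {α β S : Type} [Presented α] [Presented β] [DecidableEq S]
    (p : Prog (ι α ⊕ ι β ⊕ S)) (P : Polynomial ℕ) (f : α → β) : Prop :=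
  ∀ a, size (f a) ≤ P.eval (size a) ∧ ∃ t ≤ P.eval (size a),
    Eval p (regs (enc a) (fun _ => []) fun _ => []) (regs (enc a) (enc (f a)) fun _ => []) t

/-- The function `f` can be computed in polynomial time. -/
def FP {α β : Type} [Presented α] [Presented β] (f : α → β) : Prop :=
  ∃ (S : Type) (_ : Fintype S) (_ : DecidableEq S) (p : Prog (ι α ⊕ ι β ⊕ S))
    (P : Polynomial ℕ), Computes p P f

variable {α β γ δ : Type} [Presented α] [Presented β] [Presented γ] [Presented δ]

theorem eval_mono (P : Polynomial ℕ) {m n : ℕ} (h : m ≤ n) : P.eval m ≤ P.eval n := by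
  rw [Polynomial.eval_eq_sum_range, Polynomial.eval_eq_sum_range]
  gcongr

theorem FP.size_le {f : α → β} (hf : FP f) :
    ∃ P : Polynomial ℕ, ∀ a, size (f a) ≤ P.eval (size a) := by
  obtain ⟨_, _, _, _, P, h⟩ := hf
  exact ⟨P, fun a => (h a).1⟩

/-- Rearranging, duplicating and forgetting parts of the data takes polynomial time. -/
theorem FP.wiring (f : α → β) (φ : ι β → ι α) (h : ∀ a j, enc (f a) j = enc a (φ j)) : FP f := by
  refine ⟨Unit, inferInstance, inferInstance,
    forAll fun j => copy (.inl (φ j)) (.inr (.inl j)) (.inr (.inr ())),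
    Polynomial.C (Fintype.card (ι β)) * (4 * Polynomial.X + 2) + 1, fun a => ?_⟩
  have hs : ∀ j, (enc a (φ j)).length ≤ size a := fun j => length_enc_le_size _ _
  have hcopy := eval_forAll (fun j : ι β => copy (K := ι α ⊕ ι β ⊕ Unit) (.inl (φ j))
    (.inr (.inl j)) (.inr (.inr ())))
    (fun y => regs (enc a) y fun _ => []) (fun _ => []) (enc (f a)) (4 * size a + 2) (by
      intro y j _ hy
      refine ⟨4 * (enc a (φ j)).length + 2, by have := hs j; omega, ?_⟩
      refine (eval_copy (K := ι α ⊕ ι β ⊕ Unit) (k := .inl (φ j)) (k' := .inr (.inl j))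
        (tmp := .inr (.inr ()))
        (by simp) (by simp) (by simp) _ rfl hy).cast ?_ rfl
      simp only [regs, Sum.update_elim_inr, Sum.update_elim_inl, Sum.elim_inl, h])
  constructor
  · have : size (f a) ≤ Fintype.card (ι β) * size a := by
      rw [size, ← smul_eq_mul]
      refine Finset.sum_le_card_nsmul _ _ _ fun j _ => ?_
      rw [h]
      exact hs j
    simp only [Polynomial.eval_add, Polynomial.eval_mul, Polynomial.eval_C, Polynomial.eval_X,
      Polynomial.eval_ofNat, Polynomial.eval_one]
    nlinarith
  · obtain ⟨t, ht, he⟩ := hcopy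
    refine ⟨t, ht.trans ?_, he⟩
    simp

theorem FP.id : FP (fun a : α => a) := FP.wiring _ (fun i => i) fun _ _ => rfl

theorem FP.fst : FP (fun a : α × β => a.1) := FP.wiring _ Sum.inl fun _ _ => rfl

theorem FP.snd : FP (fun a : α × β => a.2) := FP.wiring _ Sum.inr fun _ _ => rfl

/-- The intermediate value is kept in additional scratch registers, which are cleared at the end. -/
theorem FP.comp {g : β → γ} {f : α → β} (hg : FP g) (hf : FP f) : FP (fun a => g (f a)) := by
  obtain ⟨S, _, _, p, P, hp⟩ := hf
  obtain ⟨S', _, _, p', P', hp'⟩ := hg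
  let e : Emb (ι α ⊕ ι β ⊕ S) (ι α ⊕ ι γ ⊕ (ι β ⊕ S ⊕ S')) :=
    { toFun := Sum.elim (fun i => .inl i) (Sum.elim (fun i => .inr (.inr (.inl i)))
        fun i => .inr (.inr (.inr (.inl i))))
      inv := Sum.elim (fun i => some (.inl i)) (Sum.elim (fun _ => none)
        (Sum.elim (fun i => some (.inr (.inl i))) (Sum.elim (fun i => some (.inr (.inr i)))
          fun _ => none)))
      inv_toFun := by rintro (_ | _ | _) <;> rfl
      eq_toFun := by rintro (_ | _ | _) (_ | _ | _ | _ | _) <;> simp }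
  let e' : Emb (ι β ⊕ ι γ ⊕ S') (ι α ⊕ ι γ ⊕ (ι β ⊕ S ⊕ S')) :=
    { toFun := Sum.elim (fun i => .inr (.inr (.inl i))) (Sum.elim (fun i => .inr (.inl i))
        fun i => .inr (.inr (.inr (.inr i))))
      inv := Sum.elim (fun _ => none) (Sum.elim (fun i => some (.inr (.inl i)))
        (Sum.elim (fun i => some (.inl i)) (Sum.elim (fun _ => none)
          fun i => some (.inr (.inr i)))))
      inv_toFun := by rintro (_ | _ | _) <;> rfl
      eq_toFun := by rintro (_ | _ | _) (_ | _ | _ | _ | _) <;> simp }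
  let cl : Prog (ι α ⊕ ι γ ⊕ (ι β ⊕ S ⊕ S')) :=
    forAll fun j : ι β => clear (.inr (.inr (.inl j)))
  refine ⟨_, inferInstance, inferInstance, .seq (p.rename e) (.seq (p'.rename e') cl),
    P + (P'.comp P + (Polynomial.C (Fintype.card (ι β)) * (2 * P + 1) + 1)), fun a => ?_⟩
  obtain ⟨hs, t, ht, he⟩ := hp a
  obtain ⟨hs', t', ht', he'⟩ := hp' (f a)
  have hmono := eval_mono P' hs
  have hcl := eval_forAll (fun j : ι β => clear (K := ι α ⊕ ι γ ⊕ (ι β ⊕ S ⊕ S'))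
      (.inr (.inr (.inl j))))
    (fun y => regs (enc a) (enc (g (f a))) (regs y (fun _ => []) fun _ => []))
    (enc (f a)) (fun _ => []) (2 * P.eval (size a) + 1) (by
      intro y j _ hy
      refine ⟨2 * (enc (f a) j).length + 1, ?_, ?_⟩
      · have := length_enc_le_size (f a) j
        omega
      · refine (eval_clear _ _).cast ?_ ?_
        · simp only [regs, Sum.update_elim_inr, Sum.update_elim_inl]
        · simp only [regs, Sum.elim_inr, Sum.elim_inl, hy])
  obtain ⟨t'', ht'', he''⟩ := hcl
  simp only [Polynomial.eval_add, Polynomial.eval_comp, Polynomial.eval_mul, Polynomial.eval_C,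
    Polynomial.eval_one, Polynomial.eval_ofNat]
  refine ⟨by omega, t + (t' + t''), by omega, ?_⟩
  have h1 := he.rename e fun _ => []
  have h2 := he'.rename e' (regs (enc a) (fun _ => []) fun _ => [])
  have e1 : e.over (regs (enc a) (fun _ => []) fun _ => []) (fun _ => []) =
      regs (enc a) (fun _ => []) (fun _ => []) := by
    funext k; rcases k with _ | _ | _ | _ | _ <;> rfl
  have e2 : e.over (regs (enc a) (enc (f a)) fun _ => []) (fun _ => []) =
      e'.over (regs (enc (f a)) (fun _ => []) fun _ => []) (regs (enc a) (fun _ => []) fun _ => [])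
      := by
    funext k; rcases k with _ | _ | _ | _ | _ <;> rfl
  have e3 : e'.over (regs (enc (f a)) (enc (g (f a))) fun _ => [])
      (regs (enc a) (fun _ => []) fun _ => []) =
      regs (enc a) (enc (g (f a))) (regs (enc (f a)) (fun _ => []) fun _ => []) := by
    funext k; rcases k with _ | _ | _ | _ | _ <;> rfl
  have e4 : (regs (enc a) (enc (g (f a))) (regs (fun _ => []) (fun _ => []) fun _ => []) :
      ι α ⊕ ι γ ⊕ (ι β ⊕ S ⊕ S') → List Γ') =
      regs (enc a) (enc (g (f a))) fun _ => [] := by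
    funext k; rcases k with _ | _ | _ | _ | _ <;> rfl
  rw [e1, e2] at h1
  rw [e3] at h2
  rw [e4] at he''
  exact .seq h1 (.seq h2 he'')

theorem FP.pair {f : α → β} {g : α → γ} (hf : FP f) (hg : FP g) : FP (fun a => (f a, g a)) := by
  obtain ⟨S, _, _, p, P, hp⟩ := hf
  obtain ⟨S', _, _, p', P', hp'⟩ := hg
  let e : Emb (ι α ⊕ ι β ⊕ S) (ι α ⊕ (ι β ⊕ ι γ) ⊕ (S ⊕ S')) :=
    { toFun := Sum.elim (fun i => .inl i) (Sum.elim (fun i => .inr (.inl (.inl i)))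
        fun i => .inr (.inr (.inl i)))
      inv := Sum.elim (fun i => some (.inl i)) (Sum.elim
        (Sum.elim (fun i => some (.inr (.inl i))) fun _ => none)
        (Sum.elim (fun i => some (.inr (.inr i))) fun _ => none))
      inv_toFun := by rintro (_ | _ | _) <;> rfl
      eq_toFun := by rintro (_ | _ | _) (_ | (_ | _) | _ | _) <;> simp }
  let e' : Emb (ι α ⊕ ι γ ⊕ S') (ι α ⊕ (ι β ⊕ ι γ) ⊕ (S ⊕ S')) :=
    { toFun := Sum.elim (fun i => .inl i) (Sum.elim (fun i => .inr (.inl (.inr i)))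
        fun i => .inr (.inr (.inr i)))
      inv := Sum.elim (fun i => some (.inl i)) (Sum.elim
        (Sum.elim (fun _ => none) fun i => some (.inr (.inl i)))
        (Sum.elim (fun _ => none) fun i => some (.inr (.inr i))))
      inv_toFun := by rintro (_ | _ | _) <;> rfl
      eq_toFun := by rintro (_ | _ | _) (_ | (_ | _) | _ | _) <;> simp }
  refine ⟨_, inferInstance, inferInstance, .seq (p.rename e) (p'.rename e'), P + P', fun a => ?_⟩
  obtain ⟨hs, t, ht, he⟩ := hp a
  obtain ⟨hs', t', ht', he'⟩ := hp' a
  rw [size_prod, Polynomial.eval_add]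
  refine ⟨by simp only; omega, t + t', by omega, ?_⟩
  have h1 := he.rename e fun _ => []
  have h2 := he'.rename e' (regs (fun _ => []) (Sum.elim (enc (f a)) fun _ => []) fun _ => [])
  have e1 : e.over (regs (enc a) (fun _ => []) fun _ => []) (fun _ => []) =
      regs (enc a) (fun _ => []) (fun _ => []) := by
    funext k; rcases k with _ | (_ | _) | _ | _ <;> rfl
  have e2 : e.over (regs (enc a) (enc (f a)) fun _ => []) (fun _ => []) =
      e'.over (regs (enc a) (fun _ => []) fun _ => [])
        (regs (fun _ => []) (Sum.elim (enc (f a)) fun _ => []) fun _ => []) := by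
    funext k; rcases k with _ | (_ | _) | _ | _ <;> rfl
  have e3 : e'.over (regs (enc a) (enc (g a)) fun _ => [])
      (regs (fun _ => []) (Sum.elim (enc (f a)) fun _ => []) fun _ => []) =
      regs (enc a) (enc (f a, g a)) fun _ => [] := by
    funext k; rcases k with _ | (_ | _) | _ | _ <;> rfl
  rw [e1, e2] at h1
  rw [e3] at h2
  exact .seq h1 h2

/-- Branching on the top symbol of one of the strings. -/
theorem FP.ite_head {f g : α → β} (hf : FP f) (hg : FP g) (k : ι α) (c : Option Γ' → Bool) :
    FP (fun a => if c (enc a k).head? then f a else g a) := by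
  obtain ⟨S, _, _, p, P, hp⟩ := hf
  obtain ⟨S', _, _, p', P', hp'⟩ := hg
  let e : Emb (ι α ⊕ ι β ⊕ S) (ι α ⊕ ι β ⊕ (S ⊕ S')) :=
    { toFun := Sum.elim (fun i => .inl i) (Sum.elim (fun i => .inr (.inl i))
        fun i => .inr (.inr (.inl i)))
      inv := Sum.elim (fun i => some (.inl i)) (Sum.elim (fun i => some (.inr (.inl i)))
        (Sum.elim (fun i => some (.inr (.inr i))) fun _ => none))
      inv_toFun := by rintro (_ | _ | _) <;> rfl
      eq_toFun := by rintro (_ | _ | _) (_ | _ | _ | _) <;> simp }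
  let e' : Emb (ι α ⊕ ι β ⊕ S') (ι α ⊕ ι β ⊕ (S ⊕ S')) :=
    { toFun := Sum.elim (fun i => .inl i) (Sum.elim (fun i => .inr (.inl i))
        fun i => .inr (.inr (.inr i)))
      inv := Sum.elim (fun i => some (.inl i)) (Sum.elim (fun i => some (.inr (.inl i)))
        (Sum.elim (fun _ => none) fun i => some (.inr (.inr i))))
      inv_toFun := by rintro (_ | _ | _) <;> rfl
      eq_toFun := by rintro (_ | _ | _) (_ | _ | _ | _) <;> simp }
  refine ⟨_, inferInstance, inferInstance, .ite (.inl k) c (p.rename e) (p'.rename e'),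
    P + P' + 1, fun a => ?_⟩
  simp only [Polynomial.eval_add, Polynomial.eval_one]
  have e1 : ∀ y, e.over (regs (enc a) y fun _ => []) (fun _ => []) =
      regs (enc a) y (fun _ => []) := by
    intro y
    funext k; rcases k with _ | _ | _ | _ <;> rfl
  have e2 : ∀ y, e'.over (regs (enc a) y fun _ => []) (fun _ => []) =
      regs (enc a) y (fun _ => []) := by
    intro y
    funext k; rcases k with _ | _ | _ | _ <;> rfl
  by_cases hc : c (enc a k).head? = true
  · obtain ⟨hs, t, ht, he⟩ := hp a
    have h1 := he.rename e fun _ => []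
    rw [e1, e1] at h1
    rw [if_pos hc]
    exact ⟨by omega, t + 1, by omega, .ite_true hc h1⟩
  · obtain ⟨hs, t, ht, he⟩ := hp' a
    have h1 := he.rename e' fun _ => []
    rw [e2, e2] at h1
    rw [if_neg hc]
    exact ⟨by omega, t + 1, by omega, .ite_false (by simpa using hc) h1⟩

theorem FP.nil : FP (fun _ : α => ([] : List Γ')) :=
  ⟨Empty, inferInstance, inferInstance, .nop, 1, fun a => ⟨by simp [size_list], 1, by simp,
    (Eval.nop _).cast (by funext k; rcases k with _ | _ | _ <;> rfl) rfl⟩⟩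

theorem FP.symbol (c : Γ') : FP (fun _ : α => c) :=
  ⟨Empty, inferInstance, inferInstance, .push (.inr (.inl ())) c, 1, fun a =>
    ⟨by simp [size_symbol], 1, by simp,
      (Eval.push _ _ _).cast (by funext k; rcases k with _ | _ | _ <;> simp [regs]; rfl) rfl⟩⟩

theorem FP.cons : FP (fun x : Γ' × List Γ' => x.1 :: x.2) := by
  refine ⟨Unit, inferInstance, inferInstance,
    .seq (copy (.inl (.inr ())) (.inr (.inl ())) (.inr (.inr ())))
      (.seq (.move (.inl (.inl ())) [.inr (.inr ())])
        (.move (.inr (.inr ())) [.inl (.inl ()), .inr (.inl ())])), 4 * Polynomial.X + 4, ?_⟩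
  rintro ⟨a, l⟩
  simp only [size_list, size_prod, size_symbol, List.length_cons, Polynomial.eval_add,
    Polynomial.eval_mul, Polynomial.eval_ofNat, Polynomial.eval_X]
  refine ⟨by omega, (4 * l.length + 2) + (1 + 1), by omega, ?_⟩
  have h1 := eval_copy (K := ι (Γ' × List Γ') ⊕ ι (List Γ') ⊕ Unit)
    (k := .inl (.inr ())) (k' := .inr (.inl ())) (tmp := .inr (.inr ()))
    (by simp) (by simp) (by simp) (regs (enc (a, l)) (fun _ => []) fun _ => []) rfl rfl
  refine .seq h1 (.seq (.move_cons _ _ _ a [] ?_) ((Eval.move_cons _ _ _ a [] ?_).cast ?_ rfl))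
  · rfl
  · rfl
  · funext k
    rcases k with ((_ | _) | _ | _) <;> rfl

theorem FP.tail : FP (fun l : List Γ' => l.tail) := by
  refine ⟨Unit, inferInstance, inferInstance,
    .seq (copy (.inl ()) (.inr (.inl ())) (.inr (.inr ())))
      (.move (.inr (.inl ())) []), 4 * Polynomial.X + 3, ?_⟩
  intro l
  simp only [size_list, List.length_tail, Polynomial.eval_add,
    Polynomial.eval_mul, Polynomial.eval_ofNat, Polynomial.eval_X]
  refine ⟨by omega, (4 * l.length + 2) + 1, by omega, ?_⟩
  have h1 := eval_copy (K := ι (List Γ') ⊕ ι (List Γ') ⊕ Unit)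
    (k := .inl ()) (k' := .inr (.inl ())) (tmp := .inr (.inr ()))
    (by simp) (by simp) (by simp) (regs (enc l) (fun _ => []) fun _ => []) rfl rfl
  refine .seq h1 ?_
  cases l with
  | nil =>
    refine (Eval.move_nil _ _ _ rfl).cast ?_ rfl
    funext k; rcases k with (_ | _ | _) <;> rfl
  | cons a l =>
    refine (Eval.move_cons _ _ _ a l (by rfl)).cast ?_ rfl
    funext k; rcases k with (_ | _ | _) <;> rfl

theorem FP.headD : FP (fun l : List Γ' => l.headD Γ'.blank) := by
  refine ⟨Unit, inferInstance, inferInstance,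
    .ite (.inl ()) Option.isSome (.seq (.move (.inl ()) [.inr (.inr ())])
        (.move (.inr (.inr ())) [.inl (), .inr (.inl ())])) (.push (.inr (.inl ())) Γ'.blank), 3, ?_⟩
  intro l
  simp only [size_symbol, Polynomial.eval_ofNat]
  refine ⟨by omega, ?_⟩
  cases l with
  | nil =>
    refine ⟨1 + 1, by simp, .ite_false rfl ((Eval.push _ _ _).cast ?_ rfl)⟩
    funext k; rcases k with (_ | _ | _) <;> rfl
  | cons a l =>
    refine ⟨1 + 1 + 1, by simp, .ite_true rfl (.seq (.move_cons _ _ _ a l rfl)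
      ((Eval.move_cons _ _ _ a [] (by rfl)).cast ?_ rfl))⟩
    funext k; rcases k with (_ | _ | _) <;> rfl

/-! ### Bounded iteration -/

/-- A loop that replaces `b` by `step (a, b)` in every round. -/
theorem eval_loop_iterate {β K : Type} [DecidableEq K] {p : Prog K} {c : K}
    (σ : β → List Γ' → K → List Γ') (hσ : ∀ b l, σ b l c = l) (f : β → β) (T : ℕ) (l : List Γ')
    (b : β)
    (h : ∀ m < l.length, ∀ x l', ∃ t ≤ T, Eval p (σ (f^[m] b) (x :: l')) (σ (f^[m + 1] b) l') t) :
    ∃ t ≤ l.length * (T + 1) + 1, Eval (.loop c p) (σ b l) (σ (f^[l.length] b) []) t := by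
  induction l generalizing b with
  | nil => exact ⟨1, by simp, .loop_nil (hσ _ _)⟩
  | cons x l ih =>
    obtain ⟨t, ht, he⟩ := h 0 (by simp) x l
    obtain ⟨t', ht', he'⟩ := ih (f b) fun m hm x l' => h (m + 1) (by simpa using hm) x l'
    refine ⟨t + t' + 1, ?_, .loop_cons (by simp [hσ]) he he'⟩
    simp only [List.length_cons]
    linarith

/-- The registers of a program for bounded iteration: input, result, remaining rounds, temporary
storage, result of the current round, and scratch registers of three programs. -/
abbrev LoopReg (A B S₁ S₂ S₃ : Type) : Type := A ⊕ B ⊕ (Unit ⊕ Unit ⊕ B ⊕ S₁ ⊕ S₂ ⊕ S₃)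

set_option synthInstance.maxSize 2000 in
/-- Iterating a polynomial-time function takes polynomial time, if the number of rounds is given
by the length of a string, and the sizes of all intermediate results are polynomially bounded. -/
theorem FP.iterate_of_size_le {count : α → List Γ'} {start : α → β} {step : α × β → β}
    (hc : FP count) (hi : FP start) (hs : FP step) (Q : Polynomial ℕ)
    (hQ : ∀ a, ∀ m ≤ (count a).length,
      size ((fun b => step (a, b))^[m] (start a)) ≤ Q.eval (size a)) :
    FP (fun a => (fun b => step (a, b))^[(count a).length] (start a)) := by
  obtain ⟨S₁, _, _, p₁, P₁, h₁⟩ := hc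
  obtain ⟨S₂, _, _, p₂, P₂, h₂⟩ := hi
  obtain ⟨S₃, _, _, p₃, P₃, h₃⟩ := hs
  let C : LoopReg (ι α) (ι β) S₁ S₂ S₃ := .inr (.inr (.inl ()))
  let tmp : LoopReg (ι α) (ι β) S₁ S₂ S₃ := .inr (.inr (.inr (.inl ())))
  let B : ι β → LoopReg (ι α) (ι β) S₁ S₂ S₃ := fun j => .inr (.inl j)
  let B' : ι β → LoopReg (ι α) (ι β) S₁ S₂ S₃ := fun j => .inr (.inr (.inr (.inr (.inl j))))
  let e₁ : Emb (ι α ⊕ ι (List Γ') ⊕ S₁) (LoopReg (ι α) (ι β) S₁ S₂ S₃) :=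
    { toFun := Sum.elim (fun i => .inl i) (Sum.elim (fun _ => C)
        fun i => .inr (.inr (.inr (.inr (.inr (.inl i))))))
      inv := Sum.elim (fun i => some (.inl i)) (Sum.elim (fun _ => none)
        (Sum.elim (fun _ => some (.inr (.inl ()))) (Sum.elim (fun _ => none)
          (Sum.elim (fun _ => none) (Sum.elim (fun i => some (.inr (.inr i)))
            (Sum.elim (fun _ => none) fun _ => none))))))
      inv_toFun := by rintro (_ | _ | _) <;> rfl
      eq_toFun := by
        rintro (_ | _ | _) (_ | _ | _ | _ | _ | _ | _ | _) h <;>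
          first | (cases h; rfl) | cases h }
  let e₂ : Emb (ι α ⊕ ι β ⊕ S₂) (LoopReg (ι α) (ι β) S₁ S₂ S₃) :=
    { toFun := Sum.elim (fun i => .inl i) (Sum.elim B
        fun i => .inr (.inr (.inr (.inr (.inr (.inr (.inl i)))))))
      inv := Sum.elim (fun i => some (.inl i)) (Sum.elim (fun i => some (.inr (.inl i)))
        (Sum.elim (fun _ => none) (Sum.elim (fun _ => none)
          (Sum.elim (fun _ => none) (Sum.elim (fun _ => none)
            (Sum.elim (fun i => some (.inr (.inr i))) fun _ => none))))))
      inv_toFun := by rintro (_ | _ | _) <;> rfl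
      eq_toFun := by
        rintro (_ | _ | _) (_ | _ | _ | _ | _ | _ | _ | _) h <;>
          first | (cases h; rfl) | cases h }
  let e₃ : Emb ((ι α ⊕ ι β) ⊕ ι β ⊕ S₃) (LoopReg (ι α) (ι β) S₁ S₂ S₃) :=
    { toFun := Sum.elim (Sum.elim (fun i => .inl i) B) (Sum.elim B'
        fun i => .inr (.inr (.inr (.inr (.inr (.inr (.inr i)))))))
      inv := Sum.elim (fun i => some (.inl (.inl i))) (Sum.elim (fun i => some (.inl (.inr i)))
        (Sum.elim (fun _ => none) (Sum.elim (fun _ => none)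
          (Sum.elim (fun i => some (.inr (.inl i))) (Sum.elim (fun _ => none)
            (Sum.elim (fun _ => none) fun i => some (.inr (.inr i))))))))
      inv_toFun := by rintro ((_ | _) | _ | _) <;> rfl
      eq_toFun := by
        rintro ((_ | _) | _ | _) (_ | _ | _ | _ | _ | _ | _ | _) h <;>
          first | (cases h; rfl) | cases h }
  let σ : α → (ι β → List Γ') → (ι β → List Γ') → List Γ' →
      LoopReg (ι α) (ι β) S₁ S₂ S₃ → List Γ' := fun a y z l =>
    regs (enc a) y (Sum.elim (fun _ => l) (Sum.elim (fun _ => [])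
      (Sum.elim z (Sum.elim (fun _ => []) (Sum.elim (fun _ => []) fun _ => [])))))
  -- one round: count down, compute the next value, and replace the current value by it
  let body : Prog (LoopReg (ι α) (ι β) S₁ S₂ S₃) := .seq (.move C []) (.seq (p₃.rename e₃)
    (.seq (forAll fun j => clear (B j)) (forAll fun j => shift (B' j) (B j) tmp)))
  let n : Polynomial ℕ := Polynomial.C (Fintype.card (ι β))
  let T : Polynomial ℕ := 1 + (P₃.comp (Polynomial.X + Q) +
    ((n * (2 * Q + 1) + 1) + (n * (4 * Q + 2) + 1)))
  refine ⟨_, inferInstance, inferInstance,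
    .seq (p₁.rename e₁) (.seq (p₂.rename e₂) (.loop C body)),
    P₁ + (P₂ + (P₁ * (T + 1) + 1)) + Q, fun a => ?_⟩
  set f := fun b => step (a, b) with hf
  obtain ⟨hs₁, t₁, ht₁, he₁⟩ := h₁ a
  obtain ⟨hs₂, t₂, ht₂, he₂⟩ := h₂ a
  have hbody : ∀ m < (count a).length, ∀ x l', ∃ t ≤ T.eval (size a),
      Eval body (σ a (enc (f^[m] (start a))) (fun _ => []) (x :: l'))
        (σ a (enc (f^[m + 1] (start a))) (fun _ => []) l') t := by
    intro m hm x l'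
    have hQm := hQ a m hm.le
    have hQm' := hQ a (m + 1) hm
    rw [Function.iterate_succ_apply'] at hQm' ⊢
    rw [← hf] at hQm hQm'
    set b := f^[m] (start a) with hb
    obtain ⟨hs₃, t₃, ht₃, he₃⟩ := h₃ (a, b)
    have hs3 : size (a, b) ≤ size a + Q.eval (size a) := by
      rw [size_prod]; simp only; omega
    have ht3 := ht₃.trans (eval_mono P₃ hs3)
    have hmv : Eval (.move C []) (σ a (enc b) (fun _ => []) (x :: l'))
        (σ a (enc b) (fun _ => []) l') 1 := by
      refine (Eval.move_cons _ _ _ x l' (by rfl)).cast ?_ rfl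
      funext k
      rcases k with (_ | _ | _ | _ | _ | _ | _ | _) <;> rfl
    have hst := he₃.rename e₃ (σ a (fun _ => []) (fun _ => []) l')
    have e1 : e₃.over (regs (enc (a, b)) (fun _ => []) fun _ => [])
        (σ a (fun _ => []) (fun _ => []) l') = σ a (enc b) (fun _ => []) l' := by
      funext k
      rcases k with (_ | _ | _ | _ | _ | _ | _ | _) <;> rfl
    have e2 : e₃.over (regs (enc (a, b)) (enc (f b)) fun _ => [])
        (σ a (fun _ => []) (fun _ => []) l') = σ a (enc b) (enc (f b)) l' := by
      funext k
      rcases k with (_ | _ | _ | _ | _ | _ | _ | _) <;> rfl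
    rw [e1, e2] at hst
    obtain ⟨t₄, ht₄, he₄⟩ := eval_forAll (fun j => clear (B j))
      (fun y => σ a y (enc (f b)) l') (enc b) (fun _ => []) (2 * Q.eval (size a) + 1) (by
        intro y j _ hy
        refine ⟨2 * (enc b j).length + 1, ?_, ?_⟩
        · have := length_enc_le_size b j
          omega
        · refine (eval_clear _ _).cast ?_ ?_
          · simp only [σ, B, regs, Sum.update_elim_inr, Sum.update_elim_inl]
          · simp only [σ, B, regs, Sum.elim_inr, Sum.elim_inl, hy])
    obtain ⟨t₅, ht₅, he₅⟩ := eval_forAll (fun j => shift (B' j) (B j) tmp)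
      (fun y => σ a (fun j => (y j).1) (fun j => (y j).2) l')
      (fun j => ([], enc (f b) j)) (fun j => (enc (f b) j, [])) (4 * Q.eval (size a) + 2) (by
        intro y j _ hy
        have hy1 : (y j).1 = [] := by rw [hy]
        have hy2 : (y j).2 = enc (f b) j := by rw [hy]
        refine ⟨4 * (enc (f b) j).length + 2, ?_, ?_⟩
        · have := length_enc_le_size (f b) j
          have : size (f b) ≤ Q.eval (size a) := hQm'
          omega
        · refine (eval_shift (k := B' j) (k' := B j) (tmp := tmp) (by simp [B, B'])
            (by simp [B', tmp]) (by simp [B, tmp])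
            (σ a (fun j => (y j).1) (fun j => (y j).2) l') rfl hy1).cast ?_ ?_
          · have e3 : (fun i => (Function.update y j (enc (f b) j, []) i).1) =
                Function.update (fun i => (y i).1) j (enc (f b) j) := by
              funext i
              by_cases hi : i = j
              · subst hi; simp
              · simp [hi]
            have e4 : (fun i => (Function.update y j (enc (f b) j, []) i).2) =
                Function.update (fun i => (y i).2) j [] := by
              funext i
              by_cases hi : i = j
              · subst hi; simp
              · simp [hi]
            rw [e3, e4]
            simp only [σ, B, B', regs, Sum.update_elim_inr, Sum.update_elim_inl, Sum.elim_inr,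
              Sum.elim_inl, hy2]
          · simp only [σ, B', regs, Sum.elim_inr, Sum.elim_inl, hy2])
    refine ⟨1 + (t₃ + (t₄ + t₅)), ?_, .seq hmv (.seq hst (.seq he₄ he₅))⟩
    simp only [T, n, Polynomial.eval_add, Polynomial.eval_comp, Polynomial.eval_mul,
      Polynomial.eval_C, Polynomial.eval_one, Polynomial.eval_ofNat, Polynomial.eval_X]
    omega
  obtain ⟨t₆, ht₆, he₆⟩ := eval_loop_iterate (p := body) (c := C)
    (fun b l => σ a (enc b) (fun _ => []) l) (fun _ _ => rfl) f (T.eval (size a)) (count a)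
    (start a) hbody
  have hQn := hQ a _ le_rfl
  rw [← hf] at hQn
  rw [size_list] at hs₁
  have hle : (count a).length * (T.eval (size a) + 1) ≤
      P₁.eval (size a) * (T.eval (size a) + 1) := Nat.mul_le_mul_right _ hs₁
  simp only [Polynomial.eval_add, Polynomial.eval_mul, Polynomial.eval_one]
  change size (f^[(count a).length] (start a)) ≤ _ ∧ ∃ t ≤ _, Eval _ _
    (regs (enc a) (enc (f^[(count a).length] (start a))) _) t
  refine ⟨by omega, t₁ + (t₂ + t₆), by omega, ?_⟩
  have g1 := he₁.rename e₁ fun _ => []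
  have g2 := he₂.rename e₂ (σ a (fun _ => []) (fun _ => []) (count a))
  have E1 : e₁.over (regs (enc a) (fun _ => []) fun _ => []) (fun _ => []) =
      regs (enc a) (fun _ => []) (fun _ => []) := by
    funext k; rcases k with (_ | _ | _ | _ | _ | _ | _ | _) <;> rfl
  have E2 : e₁.over (regs (enc a) (enc (count a)) fun _ => []) (fun _ => []) =
      e₂.over (regs (enc a) (fun _ => []) fun _ => [])
        (σ a (fun _ => []) (fun _ => []) (count a)) := by
    funext k; rcases k with (_ | _ | _ | _ | _ | _ | _ | _) <;> rfl
  have E3 : e₂.over (regs (enc a) (enc (start a)) fun _ => [])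
      (σ a (fun _ => []) (fun _ => []) (count a)) =
      σ a (enc (start a)) (fun _ => []) (count a) := by
    funext k; rcases k with (_ | _ | _ | _ | _ | _ | _ | _) <;> rfl
  have E4 : σ a (enc (f^[(count a).length] (start a))) (fun _ => []) [] =
      regs (enc a) (enc (f^[(count a).length] (start a))) (fun _ => []) := by
    funext k; rcases k with (_ | _ | _ | _ | _ | _ | _ | _) <;> rfl
  rw [E1, E2] at g1
  rw [E3] at g2
  rw [E4] at he₆
  exact .seq g1 (.seq g2 he₆)

/-- Bounded iteration of a function that increases the size of its argument by an amount that does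
not depend on that argument. -/
theorem FP.iterate {count : α → List Γ'} {start : α → β} {step : α × β → β}
    (hc : FP count) (hi : FP start) (hs : FP step) (Q : Polynomial ℕ)
    (hQ : ∀ a b, size (step (a, b)) ≤ size b + Q.eval (size a)) :
    FP (fun a => (fun b => step (a, b))^[(count a).length] (start a)) := by
  obtain ⟨P, hP⟩ := hc.size_le
  obtain ⟨P', hP'⟩ := hi.size_le
  refine FP.iterate_of_size_le hc hi hs (P' + P * Q) fun a m hm => ?_
  have h : ∀ m, size ((fun b => step (a, b))^[m] (start a)) ≤
      size (start a) + m * Q.eval (size a) := by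
    intro m
    induction m with
    | zero => simp
    | succ m ih =>
      rw [Function.iterate_succ_apply']
      have := hQ a ((fun b => step (a, b))^[m] (start a))
      rw [Nat.succ_mul]
      omega
  have h1 := hP a
  rw [size_list] at h1
  have h2 : m * Q.eval (size a) ≤ P.eval (size a) * Q.eval (size a) :=
    Nat.mul_le_mul_right _ (hm.trans h1)
  have h3 := h m
  have h4 := hP' a
  rw [Polynomial.eval_add, Polynomial.eval_mul]
  omega

/-! ### Booleans, counters and lists -/

/-- A Boolean and the string that presents it are the same thing for a program. -/
theorem FP.bool_of_list {f : α → Bool}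
    (h : FP fun a => if f a then [Γ'.bit true] else []) : FP f := by
  obtain ⟨S, hS, hS', p, P, hp⟩ := h
  exact ⟨S, hS, hS', p, P, hp⟩

theorem FP.nat_of_list {f : α → ℕ}
    (h : FP fun a => List.replicate (f a) (Γ'.bit true)) : FP f := by
  obtain ⟨S, hS, hS', p, P, hp⟩ := h
  exact ⟨S, hS, hS', p, P, hp⟩

theorem FP.replicate {f : α → ℕ} (h : FP f) :
    FP fun a => List.replicate (f a) (Γ'.bit true) :=
  FP.comp (FP.wiring (fun n : ℕ => List.replicate n (Γ'.bit true)) (fun i => i) fun _ _ => rfl) h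

theorem FP.list_cons {f : α → Γ'} {g : α → List Γ'} (hf : FP f) (hg : FP g) :
    FP fun a => f a :: g a :=
  FP.cons.comp (hf.pair hg)

theorem FP.ite {c : α → Bool} {f g : α → β} (hc : FP c) (hf : FP f) (hg : FP g) :
    FP (fun a => if c a then f a else g a) := by
  have h := FP.ite_head (α := Bool × α) (hf.comp FP.snd) (hg.comp FP.snd) (.inl ()) Option.isSome
  convert h.comp (hc.pair FP.id) using 3 with a
  cases hca : c a <;> simp [enc]

theorem FP.const_bool (b : Bool) : FP (fun _ : α => b) := by
  refine FP.bool_of_list ?_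
  cases b
  · exact FP.nil
  · exact FP.list_cons (FP.symbol _) FP.nil

/-- Any function of a symbol with Boolean values. -/
theorem FP.symbol_test {f : α → Γ'} (t : Γ' → Bool) (hf : FP f) : FP (fun a => t (f a)) := by
  have h : FP (fun x : Γ' => t x) := by
    convert FP.ite_head (α := Γ') (FP.const_bool true) (FP.const_bool false) ()
      (fun o => o.any t) using 2 with x
    cases ht : t x <;> simp [enc, ht]
  exact h.comp hf

theorem FP.bool₂ (op : Bool → Bool → Bool) {f g : α → Bool} (hf : FP f) (hg : FP g) :
    FP fun a => op (f a) (g a) := by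
  convert FP.ite hf (FP.ite hg (FP.const_bool (op true true)) (FP.const_bool (op true false)))
    (FP.ite hg (FP.const_bool (op false true)) (FP.const_bool (op false false))) using 2 with a
  cases f a <;> cases g a <;> rfl

theorem FP.bit {f : α → Bool} (hf : FP f) : FP fun a => Γ'.bit (f a) := by
  convert FP.ite hf (FP.symbol (Γ'.bit true)) (FP.symbol (Γ'.bit false)) using 2 with a
  cases f a <;> rfl

theorem FP.zero : FP (fun _ : α => 0) := FP.nat_of_list FP.nil

theorem FP.succ {f : α → ℕ} (hf : FP f) : FP (fun a => f a + 1) :=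
  FP.nat_of_list (FP.list_cons (FP.symbol _) hf.replicate)

/-- Folding as an iteration: the symbols are taken from the string one by one. -/
theorem iterate_foldl {β : Type} (f : β → Γ' → β) (l : List Γ') (b : β) :
    (fun s : List Γ' × β => (s.1.tail, f s.2 (s.1.headD Γ'.blank)))^[l.length] (l, b) =
      ([], l.foldl f b) := by
  induction l generalizing b with
  | nil => rfl
  | cons x l ih => exact ih (f b x)

/-- Folding over a string, with bounded growth of the accumulated value. -/
theorem FP.foldl {l : α → List Γ'} {start : α → β} {f : α × β × Γ' → β}
    (hl : FP l) (hi : FP start) (hf : FP f) (Q : Polynomial ℕ)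
    (hQ : ∀ a b x, size (f (a, b, x)) ≤ size b + Q.eval (size a)) :
    FP (fun a => (l a).foldl (fun b x => f (a, b, x)) (start a)) := by
  have hs : FP (fun y : α × List Γ' × β =>
      (y.2.1.tail, f (y.1, y.2.2, y.2.1.headD Γ'.blank))) :=
    (FP.tail.comp (FP.fst.comp FP.snd)).pair (hf.comp (FP.fst.pair
      ((FP.snd.comp FP.snd).pair (FP.headD.comp (FP.fst.comp FP.snd)))))
  have h := FP.iterate hl (hl.pair hi) hs Q (by
    rintro a ⟨r, b⟩
    have := hQ a b (r.headD Γ'.blank)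
    simp only [size_prod, size_list, List.length_tail]
    omega)
  convert FP.snd.comp h using 2 with a
  exact (congrArg Prod.snd (iterate_foldl (fun b x => f (a, b, x)) (l a) (start a))).symm

theorem FP.reverse_append {f g : α → List Γ'} (hf : FP f) (hg : FP g) :
    FP fun a => (f a).reverse ++ g a := by
  have h : FP (fun a => (f a).foldl (fun b x => x :: b) (g a)) :=
    FP.foldl hf hg (f := fun y => y.2.2 :: y.2.1)
      (FP.list_cons (FP.snd.comp FP.snd) (FP.fst.comp FP.snd)) 1 (by
        intro a b x
        simp [size_list])
  convert h using 2 with a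
  rw [List.foldl_flip_cons_eq_append']

theorem FP.reverse {f : α → List Γ'} (hf : FP f) : FP fun a => (f a).reverse := by
  simpa using FP.reverse_append hf FP.nil

theorem FP.length {f : α → List Γ'} (hf : FP f) : FP fun a => (f a).length := by
  have h := FP.iterate (β := ℕ) hf FP.zero (step := fun y => y.2 + 1) (FP.succ FP.snd) 1 (by
    intro a b
    simp [size_nat])
  convert h using 2 with a
  generalize (f a).length = n
  have : ∀ m, (fun b => b + 1)^[n] m = m + n := by
    intro m
    induction n generalizing m with
    | zero => rfl
    | succ n ih => rw [Function.iterate_succ_apply, ih]; omega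
  rw [this, zero_add]

/-- The rest of the string after the first occurrence of a symbol that satisfies `t`. -/
def dropPast (t : Γ' → Bool) (l : List Γ') : List Γ' := (l.dropWhile fun x => !t x).tail

theorem FP.takeWhile (t : Γ' → Bool) {f : α → List Γ'} (hf : FP f) :
    FP fun a => (f a).takeWhile t := by
  -- the Boolean in the accumulated value tells whether the symbols seen so far satisfy `t`
  have h : FP fun a => (f a).foldl (fun (b : Bool × List Γ') x =>
      if b.1 && t x then (true, x :: b.2) else (false, b.2)) (true, []) :=
    FP.foldl (f := fun y : α × (Bool × List Γ') × Γ' =>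
        if y.2.1.1 && t y.2.2 then (true, y.2.2 :: y.2.1.2) else (false, y.2.1.2))
      hf ((FP.const_bool true).pair FP.nil)
      (FP.ite (FP.bool₂ _ (FP.fst.comp (FP.fst.comp FP.snd))
        (FP.symbol_test t (FP.snd.comp FP.snd)))
        ((FP.const_bool true).pair (FP.list_cons (FP.snd.comp FP.snd)
          (FP.snd.comp (FP.fst.comp FP.snd))))
        ((FP.const_bool false).pair (FP.snd.comp (FP.fst.comp FP.snd)))) 2 (by
        rintro a ⟨b, l⟩ x
        have h1 := size_bool true
        have h2 := size_bool false
        simp only [size_prod, Polynomial.eval_ofNat]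
        split_ifs
        · simp only [size_list, List.length_cons]
          omega
        · simp only
          omega)
  convert FP.reverse (FP.snd.comp h) using 2 with a
  have key : ∀ (l m : List Γ'), (l.foldl (fun (b : Bool × List Γ') x =>
      if b.1 && t x then (true, x :: b.2) else (false, b.2)) (false, m)).2 = m := by
    intro l m
    induction l with
    | nil => rfl
    | cons x l ih => simpa using ih
  have key' : ∀ (l m : List Γ'), (l.foldl (fun (b : Bool × List Γ') x =>
      if b.1 && t x then (true, x :: b.2) else (false, b.2)) (true, m)).2 =
        (l.takeWhile t).reverse ++ m := by
    intro l
    induction l with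
    | nil => intro m; rfl
    | cons x l ih =>
      intro m
      rw [List.foldl_cons]
      cases hx : t x
      · simp [hx, key, -Bool.and_eq_true]
      · simp [hx, ih, -Bool.and_eq_true]
  simp [key', -Bool.and_eq_true]

theorem FP.dropPast (t : Γ' → Bool) {f : α → List Γ'} (hf : FP f) :
    FP fun a => dropPast t (f a) := by
  -- the Boolean in the accumulated value tells whether the symbol has been seen
  have h : FP fun a => (f a).foldl (fun (b : Bool × List Γ') x =>
      if b.1 then (true, x :: b.2) else (t x, b.2)) (false, []) :=
    FP.foldl (f := fun y : α × (Bool × List Γ') × Γ' =>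
        if y.2.1.1 then (true, y.2.2 :: y.2.1.2) else (t y.2.2, y.2.1.2))
      hf ((FP.const_bool false).pair FP.nil)
      (FP.ite (FP.fst.comp (FP.fst.comp FP.snd))
        ((FP.const_bool true).pair (FP.list_cons (FP.snd.comp FP.snd)
          (FP.snd.comp (FP.fst.comp FP.snd))))
        ((FP.symbol_test t (FP.snd.comp FP.snd)).pair (FP.snd.comp (FP.fst.comp FP.snd)))) 2 (by
        rintro a ⟨b, l⟩ x
        have h1 := size_bool true
        have h2 := size_bool (t x)
        simp only [size_prod, Polynomial.eval_ofNat]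
        split_ifs
        · simp only [size_list, List.length_cons]
          omega
        · simp only
          omega)
  convert FP.reverse (FP.snd.comp h) using 2 with a
  have key : ∀ (l m : List Γ'), (l.foldl (fun (b : Bool × List Γ') x =>
      if b.1 then (true, x :: b.2) else (t x, b.2)) (true, m)).2 = l.reverse ++ m := by
    intro l
    induction l with
    | nil => intro m; rfl
    | cons x l ih => intro m; simpa using ih (x :: m)
  have key' : ∀ (l : List Γ'), (l.foldl (fun (b : Bool × List Γ') x =>
      if b.1 then (true, x :: b.2) else (t x, b.2)) (false, [])).2 =
        (SlackMatrix.dropPast t l).reverse := by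
    intro l
    induction l with
    | nil => rfl
    | cons x l ih =>
      rw [List.foldl_cons]
      cases hx : t x
      · simpa [hx, SlackMatrix.dropPast] using ih
      · simp [hx, key, SlackMatrix.dropPast]
  simp [key']

theorem length_dropPast_le (t : Γ' → Bool) (l : List Γ') : (dropPast t l).length ≤ l.length := by
  rw [dropPast, List.length_tail]
  have := (List.dropWhile_sublist (l := l) fun x => !t x).length_le
  omega

theorem FP.iterate_dropPast (t : Γ' → Bool) {n f : α → List Γ'} (hn : FP n) (hf : FP f) :
    FP fun a => (SlackMatrix.dropPast t)^[(n a).length] (f a) :=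
  FP.iterate hn hf (step := fun y => SlackMatrix.dropPast t y.2) (FP.dropPast t FP.snd) 0 (by
    intro a b
    simpa [size_list] using length_dropPast_le t b)

theorem FP.fin_cons {n : ℕ} {f : α → ℕ} {g : α → Fin n → ℕ} (hf : FP f) (hg : FP g) :
    FP fun a => (Fin.cons (f a) (g a) : Fin (n + 1) → ℕ) := by
  have h : FP (fun x : ℕ × (Fin n → ℕ) => (Fin.cons x.1 x.2 : Fin (n + 1) → ℕ)) := by
    refine FP.wiring _ (fun j => Fin.cases (Sum.inl j.2) (fun i => Sum.inr (i, j.2)) j.1) ?_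
    rintro ⟨a, b⟩ ⟨j, u⟩
    refine Fin.cases ?_ (fun i => ?_) j <;> rfl
  exact h.comp (hf.pair hg)

theorem FP.apply {n : ℕ} {g : α → Fin n → ℕ} (hg : FP g) (i : Fin n) : FP fun a => g a i :=
  (FP.wiring (fun x : Fin n → ℕ => x i) (fun j => (i, j)) fun _ _ => rfl).comp hg

/-! ### Properties that can be decided in polynomial time -/

/-- The property `P` can be decided by a polynomial-time function. -/
def PolyDec (P : α → Prop) : Prop := ∃ c : α → Bool, FP c ∧ ∀ a, c a = true ↔ P a

theorem PolyDec.congr {P Q : α → Prop} (h : PolyDec P) (hPQ : ∀ a, P a ↔ Q a) : PolyDec Q := by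
  obtain ⟨c, hc, h⟩ := h
  exact ⟨c, hc, fun a => (h a).trans (hPQ a)⟩

theorem PolyDec.comp {P : β → Prop} {f : α → β} (h : PolyDec P) (hf : FP f) :
    PolyDec fun a => P (f a) := by
  obtain ⟨c, hc, h⟩ := h
  exact ⟨_, hc.comp hf, fun a => h _⟩

theorem PolyDec.const (P : Prop) : PolyDec fun _ : α => P := by
  classical
  exact ⟨_, FP.const_bool (decide P), fun _ => by simp⟩

theorem PolyDec.not {P : α → Prop} (h : PolyDec P) : PolyDec fun a => ¬ P a := by
  obtain ⟨c, hc, h⟩ := h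
  exact ⟨_, FP.bool₂ (fun x _ => !x) hc hc, fun a => by simp [← h]⟩

theorem PolyDec.and {P Q : α → Prop} (h : PolyDec P) (h' : PolyDec Q) :
    PolyDec fun a => P a ∧ Q a := by
  obtain ⟨c, hc, h⟩ := h
  obtain ⟨c', hc', h'⟩ := h'
  exact ⟨_, FP.bool₂ (fun x y => x && y) hc hc', fun a => by simp [← h, ← h']⟩

theorem PolyDec.or {P Q : α → Prop} (h : PolyDec P) (h' : PolyDec Q) :
    PolyDec fun a => P a ∨ Q a :=
  (h.not.and h'.not).not.congr fun a => by tauto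

theorem PolyDec.imp {P Q : α → Prop} (h : PolyDec P) (h' : PolyDec Q) :
    PolyDec fun a => P a → Q a :=
  (h.and h'.not).not.congr fun a => by tauto

/-- Universal quantifiers over a range given in unary: all values are tried. -/
theorem PolyDec.forall_lt {P : α → ℕ → Prop} (h : PolyDec fun x : α × ℕ => P x.1 x.2)
    {n : α → ℕ} (hn : FP n) : PolyDec fun a => ∀ i < n a, P a i := by
  obtain ⟨c, hc, h⟩ := h
  have h1 := FP.iterate (β := ℕ × Bool) hn.replicate (FP.zero.pair (FP.const_bool true))
    (step := fun y => (y.2.1 + 1, y.2.2 && c (y.1, y.2.1)))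
    ((FP.succ (FP.fst.comp FP.snd)).pair (FP.bool₂ (fun x y => x && y) (FP.snd.comp FP.snd)
      (hc.comp (FP.fst.pair (FP.fst.comp FP.snd))))) 2 (by
      rintro a ⟨i, b⟩
      have := size_bool (b && c (a, i))
      simp only [size_prod, size_nat, Polynomial.eval_ofNat]
      omega)
  refine ⟨_, FP.snd.comp h1, fun a => ?_⟩
  simp only [List.length_replicate]
  generalize n a = k
  have key : ((fun b : ℕ × Bool => (b.1 + 1, b.2 && c (a, b.1)))^[k] (0, true)).1 = k ∧
      (((fun b : ℕ × Bool => (b.1 + 1, b.2 && c (a, b.1)))^[k] (0, true)).2 = true ↔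
        ∀ i < k, P a i) := by
    induction k with
    | zero => simp
    | succ k ih =>
      rw [Function.iterate_succ_apply']
      refine ⟨by simp [ih.1], ?_⟩
      simp only [Bool.and_eq_true, ih.1, ih.2, h]
      constructor
      · rintro ⟨h1, h2⟩ i hi
        rcases Nat.lt_succ_iff_lt_or_eq.mp hi with hi | rfl
        · exact h1 i hi
        · exact h2
      · exact fun h => ⟨fun i hi => h i (by omega), h k (by omega)⟩
  exact key.2

theorem PolyDec.exists_lt {P : α → ℕ → Prop} (h : PolyDec fun x : α × ℕ => P x.1 x.2)
    {n : α → ℕ} (hn : FP n) : PolyDec fun a => ∃ i < n a, P a i :=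
  (PolyDec.forall_lt (P := fun a i => ¬ P a i) h.not hn).not.congr fun a => by push Not; rfl

/-- Quantifiers over tuples of a fixed length `k` are `k` nested quantifiers. -/
theorem PolyDec.forall_tuple {k : ℕ} {P : α → (Fin k → ℕ) → Prop}
    (h : PolyDec fun x : α × (Fin k → ℕ) => P x.1 x.2)
    {n : α → ℕ} (hn : FP n) : PolyDec fun a => ∀ I : Fin k → ℕ, (∀ j, I j < n a) → P a I := by
  induction k generalizing α with
  | zero =>
    have hw : FP fun a : α => (a, (Fin.elim0 : Fin 0 → ℕ)) :=
      FP.wiring _ (Sum.elim (fun i => i) fun j => j.1.elim0) (by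
        rintro a (j | j)
        · rfl
        · exact j.1.elim0)
    refine (h.comp hw).congr fun a => ⟨fun h I _ => ?_, fun h => h _ fun j => j.elim0⟩
    rwa [Subsingleton.elim I Fin.elim0]
  | succ k ih =>
    have h1 : PolyDec fun x : (α × ℕ) × (Fin k → ℕ) => P x.1.1 (Fin.cons x.1.2 x.2) :=
      h.comp ((FP.fst.comp FP.fst).pair (FP.fin_cons (FP.snd.comp FP.fst) FP.snd))
    have h2 := ih (P := fun (x : α × ℕ) I => P x.1 (Fin.cons x.2 I)) h1 (hn.comp FP.fst)
    have h3 := PolyDec.forall_lt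
      (P := fun a i => ∀ I : Fin k → ℕ, (∀ j, I j < n a) → P a (Fin.cons i I)) h2 hn
    refine h3.congr fun a => ⟨fun h I hI => ?_, fun h i hi I hI => h _ fun j => ?_⟩
    · have := h (I 0) (hI 0) (fun j => I j.succ) fun j => hI _
      rwa [show (Fin.cons (I 0) (fun j => I j.succ) : Fin (k + 1) → ℕ) = I from
        Fin.cons_self_tail I] at this
    · exact Fin.cases hi hI j

/-! ### Binary arithmetic -/

/-- Is the symbol the binary digit one? -/
def isOne (x : Γ') : Bool := decide (x = Γ'.bit true)

/-- The value of a string of binary digits, least significant digit first. All symbols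
other than `Γ'.bit true` count as the digit zero. -/
def val : List Γ' → ℕ
  | [] => 0
  | x :: l => (isOne x).toNat + 2 * val l

theorem val_bit_cons (b : Bool) (l : List Γ') : val (Γ'.bit b :: l) = b.toNat + 2 * val l := by
  cases b <;> simp [val, isOne]

theorem val_append_singleton (l : List Γ') (x : Γ') :
    val (l ++ [x]) = val l + 2 ^ l.length * (isOne x).toNat := by
  induction l with
  | nil => simp [val]
  | cons y l ih =>
    simp only [List.cons_append, val, ih, List.length_cons]
    ring

theorem val_eq_head_tail (l : List Γ') :
    val l = (isOne (l.headD Γ'.blank)).toNat + 2 * val l.tail := by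
  cases l with
  | nil => simp [val, isOne]
  | cons x l => rfl

theorem val_natCode (n : ℕ) : val (natCode n) = n := by
  have h : ∀ m : PosNum, val ((encodePosNum m).map Γ'.bit) = m := by
    intro m
    induction m with
    | one => simp [encodePosNum, val, isOne]
    | bit0 m ih => simp [encodePosNum, val, isOne, ih]; ring
    | bit1 m ih => simp [encodePosNum, val, isOne, ih]; ring
  have h' : ∀ m : Num, val ((encodeNum m).map Γ'.bit) = m := by
    rintro (_ | m)
    · rfl
    · exact h m
  rw [natCode, encodeNat, h', Num.to_of_nat]

/-- One round of the addition of `s.1` and `s.2.1`: `s.2.2.1` is the carry, and `s.2.2.2` is the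
part of the sum that is already known, most significant digit first. -/
def addStep (s : List Γ' × List Γ' × Bool × List Γ') : List Γ' × List Γ' × Bool × List Γ' :=
  let x := isOne (s.1.headD Γ'.blank)
  let y := isOne (s.2.1.headD Γ'.blank)
  (s.1.tail, s.2.1.tail, (x && y) || (s.2.2.1 && (x || y)),
    Γ'.bit (xor (xor x y) s.2.2.1) :: s.2.2.2)

/-- Addition of binary numbers. The string `u.reverse ++ v` only serves to provide enough rounds. -/
def binAdd (u v : List Γ') : List Γ' :=
  let s := addStep^[(u.reverse ++ v).length] (u, v, false, [])
  (Γ'.bit s.2.2.1 :: s.2.2.2).reverse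

theorem isOne_bit (b : Bool) : isOne (Γ'.bit b) = b := by
  cases b <;> simp [isOne]

/-- The known part of the sum, together with the remaining digits and the carry, has a constant
value. -/
theorem iterate_addStep (n : ℕ) (u v : List Γ') (c : Bool) (w : List Γ') :
    let s := addStep^[n] (u, v, c, w)
    s.1 = u.drop n ∧ s.2.1 = v.drop n ∧ s.2.2.2.length = w.length + n ∧
      val s.2.2.2.reverse + 2 ^ s.2.2.2.length * (val s.1 + val s.2.1 + s.2.2.1.toNat) =
        val w.reverse + 2 ^ w.length * (val u + val v + c.toNat) := by
  induction n generalizing u v c w with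
  | zero => simp
  | succ n ih =>
    rw [Function.iterate_succ_apply, addStep]
    obtain ⟨h1, h2, h3, h4⟩ := ih u.tail v.tail _ (Γ'.bit (xor (xor (isOne (u.headD Γ'.blank))
      (isOne (v.headD Γ'.blank))) c) :: w)
    refine ⟨h1.trans (by simp), h2.trans (by simp), h3.trans (by simp; omega), h4.trans ?_⟩
    rw [List.reverse_cons, val_append_singleton, val_eq_head_tail u, val_eq_head_tail v,
      List.length_reverse, List.length_cons, isOne_bit]
    generalize isOne (u.headD Γ'.blank) = x
    generalize isOne (v.headD Γ'.blank) = y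
    cases x <;> cases y <;> cases c <;> simp [pow_succ] <;> ring

theorem val_binAdd (u v : List Γ') : val (binAdd u v) = val u + val v := by
  have h := iterate_addStep (u.reverse ++ v).length u v false []
  simp only at h
  obtain ⟨h1, h2, h3, h4⟩ := h
  rw [h1, h2, List.drop_of_length_le (by simp), List.drop_of_length_le (by simp)] at h4
  rw [binAdd, List.reverse_cons, val_append_singleton, isOne_bit, List.length_reverse]
  simpa [val] using h4

theorem length_binAdd (u v : List Γ') : (binAdd u v).length = u.length + v.length + 1 := by
  have h := iterate_addStep (u.reverse ++ v).length u v false []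
  simp only at h
  rw [binAdd, List.length_reverse, List.length_cons, h.2.2.1]
  simp

theorem FP.isOne_headD {f : α → List Γ'} (hf : FP f) :
    FP fun a => isOne ((f a).headD Γ'.blank) :=
  FP.symbol_test isOne (FP.headD.comp hf)

theorem FP.binAdd {f g : α → List Γ'} (hf : FP f) (hg : FP g) :
    FP fun a => binAdd (f a) (g a) := by
  have hu : FP fun y : α × List Γ' × List Γ' × Bool × List Γ' => y.2.1 := FP.fst.comp FP.snd
  have hv : FP fun y : α × List Γ' × List Γ' × Bool × List Γ' => y.2.2.1 :=
    FP.fst.comp (FP.snd.comp FP.snd)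
  have hc : FP fun y : α × List Γ' × List Γ' × Bool × List Γ' => y.2.2.2.1 :=
    FP.fst.comp (FP.snd.comp (FP.snd.comp FP.snd))
  have hw : FP fun y : α × List Γ' × List Γ' × Bool × List Γ' => y.2.2.2.2 :=
    FP.snd.comp (FP.snd.comp (FP.snd.comp FP.snd))
  have hs : FP fun y : α × List Γ' × List Γ' × Bool × List Γ' => addStep y.2 :=
    (FP.tail.comp hu).pair ((FP.tail.comp hv).pair
      ((FP.bool₂ (fun x y => x || y)
        (FP.bool₂ (fun x y => x && y) (FP.isOne_headD hu) (FP.isOne_headD hv))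
        (FP.bool₂ (fun x y => x && y) hc
          (FP.bool₂ (fun x y => x || y) (FP.isOne_headD hu) (FP.isOne_headD hv)))).pair
      (FP.list_cons (FP.bit (FP.bool₂ xor
        (FP.bool₂ xor (FP.isOne_headD hu) (FP.isOne_headD hv)) hc)) hw)))
  have h := FP.iterate (FP.reverse_append hf hg)
    (hf.pair (hg.pair ((FP.const_bool false).pair FP.nil))) hs 2 (by
      rintro a ⟨u, v, c, w⟩
      simp only [addStep, size_prod, size_list, List.length_tail, List.length_cons,
        Polynomial.eval_ofNat]
      have := size_bool ((isOne (u.headD Γ'.blank) && isOne (v.headD Γ'.blank)) ||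
        (c && (isOne (u.headD Γ'.blank) || isOne (v.headD Γ'.blank))))
      omega)
  exact FP.reverse (FP.list_cons (FP.bit (FP.fst.comp (FP.snd.comp (FP.snd.comp h))))
    (FP.snd.comp (FP.snd.comp (FP.snd.comp h))))

/-- Multiplication of binary numbers (Horner's scheme). -/
def binMul (u v : List Γ') : List Γ' :=
  u.reverse.foldl (fun w x => binAdd (Γ'.bit false :: w) (if isOne x then v else [])) []

theorem val_binMul (u v : List Γ') : val (binMul u v) = val u * val v := by
  induction u with
  | nil => simp [binMul, val]
  | cons x u ih =>
    rw [binMul, List.reverse_cons, List.foldl_append]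
    rw [binMul] at ih
    simp only [List.foldl_cons, List.foldl_nil]
    rw [val_binAdd, val_bit_cons, ih, val]
    cases isOne x
    · simp [val]; ring
    · simp; ring

theorem FP.binMul {f g : α → List Γ'} (hf : FP f) (hg : FP g) :
    FP fun a => binMul (f a) (g a) := by
  obtain ⟨P, hP⟩ := hg.size_le
  refine FP.foldl (FP.reverse hf) FP.nil
    (f := fun y => SlackMatrix.binAdd (Γ'.bit false :: y.2.1) (if isOne y.2.2 then g y.1 else []))
    (FP.binAdd (FP.list_cons (FP.symbol _) (FP.fst.comp FP.snd))
      (FP.ite (FP.symbol_test isOne (FP.snd.comp FP.snd)) (hg.comp FP.fst) FP.nil)) (P + 2) ?_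
  intro a w x
  have h := hP a
  simp only [size_list, length_binAdd, List.length_cons, Polynomial.eval_add,
    Polynomial.eval_ofNat] at h ⊢
  split_ifs
  · omega
  · simp only [List.length_nil]
    omega

/-- One round of the comparison of `s.1` and `s.2.1`: the result `s.2.2` of the comparison of
the lower digits is updated. -/
def ltStep (s : List Γ' × List Γ' × Bool) : List Γ' × List Γ' × Bool :=
  let x := isOne (s.1.headD Γ'.blank)
  let y := isOne (s.2.1.headD Γ'.blank)
  (s.1.tail, s.2.1.tail, (!x && y) || ((x == y) && s.2.2))

theorem iterate_ltStep (n : ℕ) (u v : List Γ') (c : Bool) (hu : u.length ≤ n)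
    (hv : v.length ≤ n) :
    (ltStep^[n] (u, v, c)).2.2 = true ↔ val u < val v ∨ (val u = val v ∧ c = true) := by
  induction n generalizing u v c with
  | zero =>
    have hu : u = [] := List.length_eq_zero_iff.mp (by omega)
    have hv : v = [] := List.length_eq_zero_iff.mp (by omega)
    subst hu hv
    simp
  | succ n ih =>
    rw [Function.iterate_succ_apply, ltStep]
    rw [ih _ _ _ (by simp; omega) (by simp; omega), val_eq_head_tail u, val_eq_head_tail v]
    generalize isOne (u.headD Γ'.blank) = x
    generalize isOne (v.headD Γ'.blank) = y
    cases x <;> cases y <;> cases c <;> simp <;> omega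

/-- Comparison of binary numbers. Missing leading digits count as zero, so the numbers of digits
may differ. -/
theorem PolyDec.val_lt {f g : α → List Γ'} (hf : FP f) (hg : FP g) :
    PolyDec fun a => val (f a) < val (g a) := by
  have hu : FP fun y : α × List Γ' × List Γ' × Bool => y.2.1 := FP.fst.comp FP.snd
  have hv : FP fun y : α × List Γ' × List Γ' × Bool => y.2.2.1 :=
    FP.fst.comp (FP.snd.comp FP.snd)
  have hc : FP fun y : α × List Γ' × List Γ' × Bool => y.2.2.2 :=
    FP.snd.comp (FP.snd.comp FP.snd)
  have hs : FP fun y : α × List Γ' × List Γ' × Bool => ltStep y.2 :=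
    (FP.tail.comp hu).pair ((FP.tail.comp hv).pair
      (FP.bool₂ (fun x y => x || y)
        (FP.bool₂ (fun x y => !x && y) (FP.isOne_headD hu) (FP.isOne_headD hv))
        (FP.bool₂ (fun x y => x && y)
          (FP.bool₂ (fun x y => x == y) (FP.isOne_headD hu) (FP.isOne_headD hv)) hc)))
  have h := FP.iterate (FP.reverse_append hf hg)
    (hf.pair (hg.pair (FP.const_bool false))) hs 1 (by
      rintro a ⟨u, v, c⟩
      simp only [ltStep, size_prod, size_list, List.length_tail, Polynomial.eval_one]
      have := size_bool ((!isOne (u.headD Γ'.blank) && isOne (v.headD Γ'.blank)) ||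
        ((isOne (u.headD Γ'.blank) == isOne (v.headD Γ'.blank)) && c))
      omega)
  refine ⟨_, FP.snd.comp (FP.snd.comp h), fun a => ?_⟩
  rw [iterate_ltStep _ _ _ _ (by simp) (by simp)]
  simp

/-! ### Rational arithmetic -/

/-- The rational number `(x - y) / z`, represented by three binary numbers. -/
def fracVal (x : List Γ' × List Γ' × List Γ') : ℚ := ((val x.1 : ℚ) - val x.2.1) / val x.2.2

/-- The rational-valued function `f` can be computed in polynomial time. Its values are
represented as fractions that need not be in lowest terms. -/
def RatFP (f : α → ℚ) : Prop :=
  ∃ g : α → List Γ' × List Γ' × List Γ', FP g ∧ ∀ a, val (g a).2.2 ≠ 0 ∧ fracVal (g a) = f a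

theorem RatFP.comp {f : β → ℚ} {g : α → β} (hf : RatFP f) (hg : FP g) :
    RatFP fun a => f (g a) := by
  obtain ⟨h, hh, H⟩ := hf
  exact ⟨_, hh.comp hg, fun a => H _⟩

theorem RatFP.zero : RatFP fun _ : α => 0 :=
  ⟨_, FP.nil.pair (FP.nil.pair (FP.list_cons (FP.symbol (Γ'.bit true)) FP.nil)), fun a => by
    simp [fracVal, val, isOne]⟩

theorem RatFP.one : RatFP fun _ : α => 1 :=
  ⟨_, (FP.list_cons (FP.symbol (Γ'.bit true)) FP.nil).pair
    (FP.nil.pair (FP.list_cons (FP.symbol (Γ'.bit true)) FP.nil)), fun a => by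
    simp [fracVal, val, isOne]⟩

theorem RatFP.neg {f : α → ℚ} (hf : RatFP f) : RatFP fun a => -f a := by
  obtain ⟨g, hg, h⟩ := hf
  refine ⟨_, (FP.fst.comp (FP.snd.comp hg)).pair ((FP.fst.comp hg).pair
    (FP.snd.comp (FP.snd.comp hg))), fun a => ⟨(h a).1, ?_⟩⟩
  simp only [← (h a).2, fracVal]
  ring

theorem RatFP.add {f f' : α → ℚ} (hf : RatFP f) (hf' : RatFP f') :
    RatFP fun a => f a + f' a := by
  obtain ⟨g, hg, h⟩ := hf
  obtain ⟨g', hg', h'⟩ := hf'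
  have h1 := FP.fst.comp hg
  have h2 := FP.fst.comp (FP.snd.comp hg)
  have h3 := FP.snd.comp (FP.snd.comp hg)
  have h1' := FP.fst.comp hg'
  have h2' := FP.fst.comp (FP.snd.comp hg')
  have h3' := FP.snd.comp (FP.snd.comp hg')
  refine ⟨_, (FP.binAdd (FP.binMul h1 h3') (FP.binMul h1' h3)).pair
    ((FP.binAdd (FP.binMul h2 h3') (FP.binMul h2' h3)).pair (FP.binMul h3 h3')), fun a => ⟨?_, ?_⟩⟩
  · simp only [val_binMul]
    exact Nat.mul_ne_zero (h a).1 (h' a).1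
  · have e1 : (val (g a).2.2 : ℚ) ≠ 0 := Nat.cast_ne_zero.mpr (h a).1
    have e2 : (val (g' a).2.2 : ℚ) ≠ 0 := Nat.cast_ne_zero.mpr (h' a).1
    simp only [← (h a).2, ← (h' a).2, fracVal, val_binMul, val_binAdd, Nat.cast_add, Nat.cast_mul]
    field_simp
    ring

theorem RatFP.mul {f f' : α → ℚ} (hf : RatFP f) (hf' : RatFP f') :
    RatFP fun a => f a * f' a := by
  obtain ⟨g, hg, h⟩ := hf
  obtain ⟨g', hg', h'⟩ := hf'
  have h1 := FP.fst.comp hg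
  have h2 := FP.fst.comp (FP.snd.comp hg)
  have h3 := FP.snd.comp (FP.snd.comp hg)
  have h1' := FP.fst.comp hg'
  have h2' := FP.fst.comp (FP.snd.comp hg')
  have h3' := FP.snd.comp (FP.snd.comp hg')
  refine ⟨_, (FP.binAdd (FP.binMul h1 h1') (FP.binMul h2 h2')).pair
    ((FP.binAdd (FP.binMul h1 h2') (FP.binMul h2 h1')).pair (FP.binMul h3 h3')), fun a => ⟨?_, ?_⟩⟩
  · simp only [val_binMul]
    exact Nat.mul_ne_zero (h a).1 (h' a).1
  · simp only [← (h a).2, ← (h' a).2, fracVal, val_binMul, val_binAdd, Nat.cast_add, Nat.cast_mul]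
    rw [div_mul_div_comm]
    ring

theorem RatFP.list_sum {J : Type} (l : List J) {f : J → α → ℚ} (hf : ∀ j, RatFP (f j)) :
    RatFP fun a => (l.map fun j => f j a).sum := by
  induction l with
  | nil => exact RatFP.zero
  | cons j l ih => exact (hf j).add ih

theorem RatFP.list_prod {J : Type} (l : List J) {f : J → α → ℚ} (hf : ∀ j, RatFP (f j)) :
    RatFP fun a => (l.map fun j => f j a).prod := by
  induction l with
  | nil => exact RatFP.one
  | cons j l ih => exact (hf j).mul ih

theorem RatFP.sum {J : Type} (s : Finset J) {f : J → α → ℚ} (hf : ∀ j, RatFP (f j)) :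
    RatFP fun a => ∑ j ∈ s, f j a := by
  simpa only [Finset.sum_map_toList] using RatFP.list_sum s.toList hf

theorem RatFP.prod {J : Type} (s : Finset J) {f : J → α → ℚ} (hf : ∀ j, RatFP (f j)) :
    RatFP fun a => ∏ j ∈ s, f j a := by
  simpa only [Finset.prod_map_toList] using RatFP.list_prod s.toList hf

/-- Determinants of a fixed size can be computed in polynomial time, by Leibniz' formula. -/
theorem RatFP.det {n : ℕ} {f : α → Matrix (Fin n) (Fin n) ℚ}
    (hf : ∀ i j, RatFP fun a => f a i j) : RatFP fun a => (f a).det := by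
  simp only [Matrix.det_apply']
  refine RatFP.sum _ fun σ => RatFP.mul ?_ (RatFP.prod _ fun i => hf _ _)
  rcases Int.units_eq_one_or (Equiv.Perm.sign σ) with h | h
  · simpa [h] using RatFP.one
  · simpa [h] using RatFP.one.neg

theorem PolyDec.pos {f : α → ℚ} (hf : RatFP f) : PolyDec fun a => 0 < f a := by
  obtain ⟨g, hg, h⟩ := hf
  refine (PolyDec.val_lt (FP.fst.comp (FP.snd.comp hg)) (FP.fst.comp hg)).congr fun a => ?_
  have e : (0 : ℚ) < val (g a).2.2 := Nat.cast_pos.mpr (Nat.pos_of_ne_zero (h a).1)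
  rw [← (h a).2, fracVal, div_pos_iff_of_pos_right e, sub_pos, Nat.cast_lt]

theorem PolyDec.neg {f : α → ℚ} (hf : RatFP f) : PolyDec fun a => f a < 0 :=
  (PolyDec.pos hf.neg).congr fun a => by simp

theorem PolyDec.nonneg {f : α → ℚ} (hf : RatFP f) : PolyDec fun a => 0 ≤ f a :=
  (PolyDec.neg hf).not.congr fun a => by simp

theorem PolyDec.eq_zero {f : α → ℚ} (hf : RatFP f) : PolyDec fun a => f a = 0 :=
  ((PolyDec.neg hf).not.and (PolyDec.pos hf).not).congr fun a => by
    rw [not_lt, not_lt, and_comm]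
    exact le_antisymm_iff.symm

/-! ### From polynomial-time functions to Turing machines -/

/-- The statement executed at the end of the computation: the answer is read off from the register
`k` (which is empty for `false`), and written on the answer stack. -/
def answerStmt {K Λ : Type} (k : K) : TM2.Stmt (StackSymbol (K := K)) Λ (Option Γ') :=
  .pop (some k) (fun _ h => h) (.branch Option.isSome
    (.push none (fun _ => true) (.load (fun _ => none) .halt))
    (.push none (fun _ => false) (.load (fun _ => none) .halt)))

/-- The Turing machine that executes the program `p`, empties the input register `i`, and moves the
answer from the register `o` to the answer stack. -/
def machine {K : Type} [Fintype K] [DecidableEq K] (p : Prog K) (i o : K) : FinTM2 where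
  K := Option K
  k₀ := some i
  k₁ := none
  Γ := StackSymbol
  Λ := Option (Lab (Prog.seq p (clear i)))
  main := some (entry _)
  σ := Option Γ'
  initialState := none
  Γk₀Fin := inferInstanceAs (Fintype Γ')
  m l := match l with
    | none => answerStmt o
    | some l => Prog.code (Prog.seq p (clear i)) some none l

/-- A question about presented objects can be decided in polynomial time if it agrees, on their
codes, with a property of arbitrary strings that can be decided by a polynomial-time function. -/
theorem DecidableInPolyTime.of_polyDec {α : Type} {code : α → List Γ'} {P : α → Prop}
    {Q : List Γ' → Prop} (hQ : PolyDec Q) (h : ∀ a, Q (code a) ↔ P a) :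
    DecidableInPolyTime code P := by
  obtain ⟨c, ⟨S, _, _, p, T, hp⟩, hc⟩ := hQ
  let i : ι (List Γ') ⊕ ι Bool ⊕ S := .inl ()
  let o : ι (List Γ') ⊕ ι Bool ⊕ S := .inr (.inl ())
  refine ⟨{ tm := machine p i o, inputAlphabet := Equiv.refl Γ', outputAlphabet := Equiv.refl Bool,
            time := T + 2 * Polynomial.X + 2, outputsFun := fun a => ?_ }⟩
  have hb : @decide (P a) (Classical.propDecidable (P a)) = c (code a) := by
    rw [Bool.eq_iff_iff, @decide_eq_true_eq _ (Classical.propDecidable _), hc, h]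
  have key : ∃ t ≤ T.eval (code a).length + 2 * (code a).length + 2,
      Steps (machine p i o).m t
        ⟨some (machine p i o).main, none,
          regStacks (regs (enc (code a)) (fun _ => []) fun _ => []) []⟩
        ⟨none, none, regStacks (fun _ => []) [c (code a)]⟩ := by
    obtain ⟨-, t, ht, he⟩ := hp (code a)
    have h1 := Eval.seq he (eval_clear i _)
    obtain ⟨v, h2⟩ := h1.steps (m := (machine p i o).m) [] some none (fun _ => rfl) none
    rw [size_list] at ht
    have h3 := Steps.one (m := (machine p i o).m) none v
      (regStacks (Function.update (regs (enc (code a)) (enc (c (code a))) fun _ => []) i []) [])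
    have h4 : TM2.stepAux ((machine p i o).m none) v
        (regStacks (Function.update (regs (enc (code a)) (enc (c (code a))) fun _ => []) i []) []) =
        ⟨none, none, regStacks (fun _ => []) [c (code a)]⟩ := by
      cases c (code a)
      · change TM2.Cfg.mk _ _ _ = _
        congr 1
        funext k
        rcases k with _ | _ | _ | _ <;> rfl
      · change TM2.Cfg.mk _ _ _ = _
        congr 1
        funext k
        rcases k with _ | _ | _ | _ <;> rfl
    refine ⟨_, ?_, h2.trans (Eq.trans h3 (congrArg some h4))⟩
    have : (regs (enc (code a)) (enc (c (code a))) (fun _ : S => []) i).length =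
      (code a).length := rfl
    omega
  have hstart : initList (machine p i o) (List.map (Equiv.refl Γ').invFun (code a)) =
      ⟨some (machine p i o).main, none,
        regStacks (regs (enc (code a)) (fun _ => []) fun _ => []) []⟩ := by
    refine (congrArg (initList (machine p i o)) (List.map_id (code a))).trans ?_
    refine congrArg (TM2.Cfg.mk _ _) ?_
    funext k
    rcases k with _ | _ | _ | _ <;> rfl
  have hend : haltList (machine p i o) (List.map (Equiv.refl Bool).invFun [c (code a)]) =
      ⟨none, none, regStacks (fun _ => []) [c (code a)]⟩ := by
    refine congrArg (TM2.Cfg.mk _ _) ?_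
    funext k
    rcases k with _ | _ | _ | _ <;> rfl
  choose t ht he using key
  refine ⟨⟨t, ?_⟩, ?_⟩
  · rw [hb, hstart]
    exact Eq.trans he (congrArg some hend).symm
  · simpa using ht

/-! ### Reading a matrix -/

/-- Is the symbol a comma? -/
def isComma (x : Γ') : Bool := decide (x = Γ'.comma)

/-- Is the symbol an opening bracket? -/
def isBra (x : Γ') : Bool := decide (x = Γ'.bra)

/-- The number of rows of the matrix with code `w`. -/
def numRows (w : List Γ') : ℕ := (w.takeWhile isOne).length

/-- The number of columns of the matrix with code `w`. -/
def numCols (w : List Γ') : ℕ := ((dropPast isComma w).takeWhile isOne).length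

/-- The part of the code `w` that begins with the entry in row `i` and column `j`. Every entry
is followed by two commas (after the numerator, and after the denominator). -/
def seekEntry (w : List Γ') (i j : ℕ) : List Γ' :=
  (dropPast isComma)^[2 * j] ((dropPast isBra)^[i + 1] w)

/-- The numerator at the beginning of a string. -/
def readNum (e : List Γ') : List Γ' := e.tail.takeWhile fun x => !isComma x

/-- The denominator at the beginning of a string. It is replaced by one if it is zero, which
does not happen for codes of matrices. -/
def readDen (e : List Γ') : List Γ' :=
  let d := (dropPast isComma e).takeWhile fun x => !isComma x
  if val d = 0 then [Γ'.bit true] else d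

/-- The entry in row `i` and column `j` of the matrix with code `w`. -/
def readEntry (w : List Γ') (i j : ℕ) : ℚ :=
  let e := seekEntry w i j
  (if isOne (e.headD Γ'.blank) then -(val (readNum e) : ℚ) else val (readNum e)) / val (readDen e)

theorem FP.numRows : FP numRows := FP.length (FP.takeWhile _ FP.id)

theorem FP.numCols : FP numCols := FP.length (FP.takeWhile _ (FP.dropPast _ FP.id))

theorem FP.seekEntry {f : α → List Γ'} {g h : α → ℕ} (hf : FP f) (hg : FP g) (hh : FP h) :
    FP fun a => seekEntry (f a) (g a) (h a) := by
  have h1 := FP.iterate_dropPast isBra (FP.succ hg).replicate hf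
  have h2 := FP.iterate_dropPast isComma hh.replicate (FP.iterate_dropPast isComma hh.replicate h1)
  simp only [List.length_replicate, ← Function.iterate_add_apply, ← two_mul] at h2
  exact h2

theorem RatFP.readEntry {f : α → List Γ'} {g h : α → ℕ} (hf : FP f) (hg : FP g) (hh : FP h) :
    RatFP fun a => readEntry (f a) (g a) (h a) := by
  have he := FP.seekEntry hf hg hh
  have hs := FP.isOne_headD he
  have hn : FP fun a => readNum (SlackMatrix.seekEntry (f a) (g a) (h a)) :=
    FP.takeWhile _ (FP.tail.comp he)
  have hd : FP fun a => readDen (SlackMatrix.seekEntry (f a) (g a) (h a)) := by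
    have h1 : FP fun e : List Γ' => (SlackMatrix.dropPast isComma e).takeWhile fun x => !isComma x :=
      FP.takeWhile _ (FP.dropPast _ FP.id)
    obtain ⟨c, hc, hc'⟩ := PolyDec.val_lt FP.nil h1
    have h2 := FP.ite hc h1 (FP.list_cons (FP.symbol (Γ'.bit true)) FP.nil)
    convert h2.comp he using 2 with a
    simp only [hc', readDen, val, Nat.pos_iff_ne_zero, ne_eq, ite_not]
  refine ⟨_, (FP.ite hs FP.nil hn).pair ((FP.ite hs hn FP.nil).pair hd), fun a => ⟨?_, ?_⟩⟩
  · simp only [readDen]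
    split_ifs with h0
    · simp [val, isOne]
    · exact h0
  · simp only [fracVal, SlackMatrix.readEntry]
    cases isOne ((SlackMatrix.seekEntry (f a) (g a) (h a)).headD Γ'.blank) <;> simp [val]

theorem dropPast_append (t : Γ' → Bool) (u v : List Γ') (c : Γ') (hu : ∀ x ∈ u, t x = false)
    (hc : t c = true) : dropPast t (u ++ c :: v) = v := by
  rw [dropPast, List.dropWhile_append_of_pos (by simpa using hu)]
  simp [hc]

theorem takeWhile_append (t : Γ' → Bool) (u v : List Γ') (c : Γ') (hu : ∀ x ∈ u, t x = true)
    (hc : t c = false) : (u ++ c :: v).takeWhile t = u := by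
  rw [List.takeWhile_append_of_pos hu]
  simp [hc]

theorem numRows_matrixCode {p q : ℕ} (M : Matrix (Fin p) (Fin q) ℚ) :
    numRows (matrixCode M) = p := by
  rw [numRows, matrixCode, takeWhile_append]
  · simp
  · intro x hx
    rw [List.eq_of_mem_replicate hx]
    rfl
  · rfl

theorem dropPast_matrixCode {p q : ℕ} (M : Matrix (Fin p) (Fin q) ℚ) :
    dropPast isComma (matrixCode M) = List.replicate q (Γ'.bit true) ++ Γ'.comma ::
      (List.ofFn fun i => rowCode (M i)).flatten := by
  rw [matrixCode, dropPast_append]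
  · intro x hx
    rw [List.eq_of_mem_replicate hx]
    rfl
  · rfl

theorem numCols_matrixCode {p q : ℕ} (M : Matrix (Fin p) (Fin q) ℚ) :
    numCols (matrixCode M) = q := by
  rw [numCols, dropPast_matrixCode, takeWhile_append]
  · simp
  · intro x hx
    rw [List.eq_of_mem_replicate hx]
    rfl
  · rfl

theorem isComma_natCode (n : ℕ) : ∀ x ∈ natCode n, isComma x = false := by
  intro x hx
  obtain ⟨b, -, rfl⟩ := List.mem_map.mp hx
  rfl

theorem isBra_ratCode (y : ℚ) : ∀ x ∈ ratCode y, isBra x = false := by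
  intro x hx
  simp only [ratCode, natCode, List.mem_cons, List.mem_append, List.mem_map, List.not_mem_nil,
    or_false] at hx
  rcases hx with rfl | ⟨b, -, rfl⟩ | rfl | ⟨b, -, rfl⟩ | rfl <;> rfl

theorem dropPast_isComma_ratCode (y : ℚ) (v : List Γ') :
    dropPast isComma (ratCode y ++ v) = natCode y.den ++ Γ'.comma :: v := by
  have h : ratCode y ++ v = (Γ'.bit (decide (y < 0)) :: natCode y.num.natAbs) ++
      Γ'.comma :: (natCode y.den ++ Γ'.comma :: v) := by
    simp [ratCode]
  rw [h, dropPast_append]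
  · intro x hx
    rcases List.mem_cons.mp hx with rfl | hx
    · rfl
    · exact isComma_natCode _ _ hx
  · rfl

theorem iterate_dropPast_entries (L : List ℚ) (v : List Γ') (j : ℕ) :
    j ≤ L.length → (dropPast isComma)^[2 * j] ((L.map ratCode).flatten ++ v) =
      ((L.drop j).map ratCode).flatten ++ v := by
  induction j generalizing L with
  | zero => simp
  | succ j ih =>
    intro hj
    cases L with
    | nil => simp at hj
    | cons y L =>
      rw [show 2 * (j + 1) = 2 * j + 1 + 1 by ring, Function.iterate_succ_apply,
        Function.iterate_succ_apply, List.map_cons, List.flatten_cons, List.append_assoc,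
        dropPast_isComma_ratCode, dropPast_append _ _ _ _ (isComma_natCode _) rfl,
        ih L (by simpa using hj), List.drop_succ_cons]

theorem iterate_dropPast_rows (L : List (List Γ')) (u : List Γ') (i : ℕ) (hi : i < L.length)
    (hu : ∀ x ∈ u, isBra x = false) (hL : ∀ l ∈ L, ∀ x ∈ l, isBra x = false) :
    (dropPast isBra)^[i + 1] (u ++ (L.map fun l => Γ'.bra :: l).flatten) =
      L[i] ++ ((L.drop (i + 1)).map fun l => Γ'.bra :: l).flatten := by
  induction i generalizing L u with
  | zero =>
    cases L with
    | nil => simp at hi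
    | cons l L =>
      simp only [List.map_cons, List.flatten_cons, List.cons_append, Function.iterate_succ,
        Function.iterate_zero, Function.comp, id]
      rw [dropPast_append _ _ _ _ hu rfl]
      rfl
  | succ i ih =>
    cases L with
    | nil => simp at hi
    | cons l L =>
      rw [Function.iterate_succ_apply]
      simp only [List.map_cons, List.flatten_cons, List.cons_append]
      rw [dropPast_append _ _ _ _ hu rfl, ih L l (by simpa using hi) (hL l (by simp))
        fun l hl => hL l (by simp [hl])]
      rfl

theorem seekEntry_matrixCode {p q : ℕ} (M : Matrix (Fin p) (Fin q) ℚ) (i : Fin p) (j : Fin q) :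
    ∃ v, seekEntry (matrixCode M) i j = ratCode (M i j) ++ v := by
  have hrows : (List.ofFn fun i => rowCode (M i)) = (List.ofFn fun i =>
      (List.ofFn fun j => ratCode (M i j)).flatten ++ [Γ'.ket]).map fun l => Γ'.bra :: l := by
    rw [List.map_ofFn]
    rfl
  have hent : ∀ i, (List.ofFn fun j => ratCode (M i j)) = (List.ofFn (M i)).map ratCode := by
    intro i
    rw [List.map_ofFn]
    rfl
  have hcode : matrixCode M = (List.replicate p (Γ'.bit true) ++ Γ'.comma ::
      (List.replicate q (Γ'.bit true) ++ [Γ'.comma])) ++ ((List.ofFn fun i =>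
      (List.ofFn fun j => ratCode (M i j)).flatten ++ [Γ'.ket]).map fun l => Γ'.bra :: l).flatten := by
    rw [matrixCode, hrows]
    simp
  have h1 := iterate_dropPast_rows (List.ofFn fun i =>
      (List.ofFn fun j => ratCode (M i j)).flatten ++ [Γ'.ket])
    (List.replicate p (Γ'.bit true) ++ Γ'.comma :: (List.replicate q (Γ'.bit true) ++ [Γ'.comma]))
    i (by simp) (by
      intro x hx
      simp only [List.mem_append, List.mem_cons, List.mem_replicate, List.not_mem_nil,
        or_false] at hx
      rcases hx with ⟨-, rfl⟩ | rfl | ⟨-, rfl⟩ | rfl <;> rfl) (by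
      intro l hl x hx
      simp only [List.mem_ofFn] at hl
      obtain ⟨i, rfl⟩ := hl
      simp only [List.mem_append, List.mem_flatten, List.mem_ofFn, List.mem_singleton] at hx
      rcases hx with ⟨l, ⟨j, rfl⟩, hx⟩ | rfl
      · exact isBra_ratCode _ _ hx
      · rfl)
  rw [seekEntry, hcode, h1]
  simp only [List.getElem_ofFn, List.append_assoc, hent, Fin.eta]
  rw [iterate_dropPast_entries _ _ _ (by simp), List.drop_eq_getElem_cons (by simp)]
  simp only [List.getElem_ofFn, List.map_cons, List.flatten_cons, List.append_assoc, Fin.eta]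
  exact ⟨_, rfl⟩

theorem readEntry_matrixCode {p q : ℕ} (M : Matrix (Fin p) (Fin q) ℚ) (i : Fin p) (j : Fin q) :
    readEntry (matrixCode M) i j = M i j := by
  obtain ⟨v, hv⟩ := seekEntry_matrixCode M i j
  generalize M i j = y at hv ⊢
  have hnum : readNum (ratCode y ++ v) = natCode y.num.natAbs := by
    have : (ratCode y ++ v).tail = natCode y.num.natAbs ++ Γ'.comma ::
        (natCode y.den ++ Γ'.comma :: v) := by simp [ratCode]
    rw [readNum, this, takeWhile_append]
    · intro x hx
      rw [isComma_natCode _ x hx]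
      rfl
    · rfl
  have hden : readDen (ratCode y ++ v) = natCode y.den := by
    rw [readDen, dropPast_isComma_ratCode, takeWhile_append]
    · simp [val_natCode, y.den_ne_zero]
    · intro x hx
      rw [isComma_natCode _ x hx]
      rfl
    · rfl
  have hsign : isOne ((ratCode y ++ v).headD Γ'.blank) = decide (y < 0) := by
    rw [ratCode]
    exact isOne_bit _
  have hy := Rat.num_div_den y
  simp only [readEntry, hv, hnum, hden, hsign, val_natCode, decide_eq_true_eq]
  split_ifs with h
  · have h1 : (y.num.natAbs : ℤ) = -y.num := by
      have := Rat.num_neg.mpr h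
      omega
    have h2 := congrArg (Int.cast : ℤ → ℚ) h1
    rw [Int.cast_natCast, Int.cast_neg] at h2
    rw [h2, neg_neg, hy]
  · have h1 : (y.num.natAbs : ℤ) = y.num := by
      have := Rat.num_nonneg.mpr (not_lt.mp h)
      omega
    have h2 := congrArg (Int.cast : ℤ → ℚ) h1
    rw [Int.cast_natCast] at h2
    rw [h2, hy]

/-! ### Deciding the criteria -/

theorem PolyDec.forall_fin {n : ℕ} {P : Fin n → α → Prop} (h : ∀ k, PolyDec (P k)) :
    PolyDec fun a => ∀ k, P k a := by
  induction n with
  | zero => exact (PolyDec.const True).congr fun a => by simp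
  | succ n ih => exact ((h 0).and (ih fun k => h k.succ)).congr fun a =>
    (Fin.forall_fin_succ (P := fun k => P k a)).symm

/-- The matrix with rows `I` and columns `j, J` of the array `E`. -/
def bordered (E : ℕ → ℕ → ℚ) {s : ℕ} (I : Fin (s + 1) → ℕ) (J : Fin s → ℕ) (j : ℕ) :
    Matrix (Fin (s + 1)) (Fin (s + 1)) ℚ :=
  Matrix.of fun a b => E (I a) ((Fin.cons j J : Fin (s + 1) → ℕ) b)

/-- A criterion, in terms of signs of minors, for the `p × q` matrix of rank `s + 1` with entries
`E` to satisfy the row cone generating condition. -/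
def RowCriterion (s p q : ℕ) (E : ℕ → ℕ → ℚ) : Prop :=
  (∀ i < p, ∀ j < q, 0 ≤ E i j) ∧
    ∀ I : Fin (s + 1) → ℕ, (∀ k, I k < p) → ∀ J : Fin s → ℕ, (∀ k, J k < q) →
      (∃ j < q, (bordered E I J j).det ≠ 0) →
        ((∃ j < q, (bordered E I J j).det < 0) ∧ ∃ j < q, 0 < (bordered E I J j).det) ∨
          ∃ i < p, (∀ k, E i (J k) = 0) ∧ ∃ j < q, E i j ≠ 0

/-- A criterion for the all-ones vector to be in the column span of the `p × q` matrix of rank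
`r` with entries `E`. -/
def OnesCriterion (r p q : ℕ) (E : ℕ → ℕ → ℚ) : Prop :=
  ∀ I : Fin (r + 1) → ℕ, (∀ k, I k < p) → ∀ J : Fin r → ℕ, (∀ k, J k < q) →
    (Matrix.of fun a b => (Fin.cons 1 fun k => E (I a) (J k) : Fin (r + 1) → ℚ) b).det = 0

/-- The minors have the fixed size `s + 1`, and the number of quantified indices depends on `s`
only. -/
theorem PolyDec.rowCriterion (s : ℕ) {p q : α → ℕ} (hp : FP p) (hq : FP q)
    {E : α → ℕ → ℕ → ℚ} (hE : RatFP fun x : α × ℕ × ℕ => E x.1 x.2.1 x.2.2) :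
    PolyDec fun a => RowCriterion s (p a) (q a) (E a) := by
  -- the variables are `a`, then `I`, then `J`, then an index of a row or of a column
  have hdet : RatFP fun x : ((α × (Fin (s + 1) → ℕ)) × (Fin s → ℕ)) × ℕ =>
      (bordered (E x.1.1.1) x.1.1.2 x.1.2 x.2).det := by
    refine RatFP.det fun a b => ?_
    exact hE.comp ((FP.fst.comp (FP.fst.comp FP.fst)).pair
      ((FP.apply (FP.snd.comp (FP.fst.comp FP.fst)) a).pair
        (FP.apply (FP.fin_cons FP.snd (FP.snd.comp FP.fst)) b)))
  have hq' : FP fun x : (α × (Fin (s + 1) → ℕ)) × (Fin s → ℕ) => q x.1.1 :=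
    hq.comp (FP.fst.comp FP.fst)
  have hp' : FP fun x : (α × (Fin (s + 1) → ℕ)) × (Fin s → ℕ) => p x.1.1 :=
    hp.comp (FP.fst.comp FP.fst)
  refine PolyDec.and ?_ ?_
  · refine PolyDec.forall_lt (P := fun a i => ∀ j < q a, 0 ≤ E a i j) ?_ hp
    refine PolyDec.forall_lt (P := fun (x : α × ℕ) j => 0 ≤ E x.1 x.2 j) ?_ (hq.comp FP.fst)
    exact PolyDec.nonneg (hE.comp ((FP.fst.comp FP.fst).pair ((FP.snd.comp FP.fst).pair FP.snd)))
  · refine PolyDec.forall_tuple (P := fun a I => ∀ J : Fin s → ℕ, (∀ k, J k < q a) →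
      (∃ j < q a, (bordered (E a) I J j).det ≠ 0) →
        ((∃ j < q a, (bordered (E a) I J j).det < 0) ∧ ∃ j < q a, 0 < (bordered (E a) I J j).det) ∨
          ∃ i < p a, (∀ k, E a i (J k) = 0) ∧ ∃ j < q a, E a i j ≠ 0) ?_ hp
    refine PolyDec.forall_tuple (P := fun (x : α × (Fin (s + 1) → ℕ)) J =>
      (∃ j < q x.1, (bordered (E x.1) x.2 J j).det ≠ 0) →
        ((∃ j < q x.1, (bordered (E x.1) x.2 J j).det < 0) ∧
          ∃ j < q x.1, 0 < (bordered (E x.1) x.2 J j).det) ∨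
          ∃ i < p x.1, (∀ k, E x.1 i (J k) = 0) ∧ ∃ j < q x.1, E x.1 i j ≠ 0) ?_
      (hq.comp FP.fst)
    refine PolyDec.imp ?_ (PolyDec.or (PolyDec.and ?_ ?_) ?_)
    · exact PolyDec.exists_lt (P := fun (x : (α × (Fin (s + 1) → ℕ)) × (Fin s → ℕ)) j =>
        (bordered (E x.1.1) x.1.2 x.2 j).det ≠ 0) (PolyDec.eq_zero hdet).not hq'
    · exact PolyDec.exists_lt (P := fun (x : (α × (Fin (s + 1) → ℕ)) × (Fin s → ℕ)) j =>
        (bordered (E x.1.1) x.1.2 x.2 j).det < 0) (PolyDec.neg hdet) hq'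
    · exact PolyDec.exists_lt (P := fun (x : (α × (Fin (s + 1) → ℕ)) × (Fin s → ℕ)) j =>
        0 < (bordered (E x.1.1) x.1.2 x.2 j).det) (PolyDec.pos hdet) hq'
    · refine PolyDec.exists_lt (P := fun (x : (α × (Fin (s + 1) → ℕ)) × (Fin s → ℕ)) i =>
        (∀ k, E x.1.1 i (x.2 k) = 0) ∧ ∃ j < q x.1.1, E x.1.1 i j ≠ 0) ?_ hp'
      refine PolyDec.and (PolyDec.forall_fin fun k => PolyDec.eq_zero ?_) ?_
      · exact hE.comp ((FP.fst.comp (FP.fst.comp FP.fst)).pair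
          (FP.snd.pair (FP.apply (FP.snd.comp FP.fst) k)))
      · refine PolyDec.exists_lt (P := fun (x : ((α × (Fin (s + 1) → ℕ)) × (Fin s → ℕ)) × ℕ) j =>
          E x.1.1.1 x.2 j ≠ 0) (PolyDec.eq_zero ?_).not (hq'.comp FP.fst)
        exact hE.comp ((FP.fst.comp (FP.fst.comp (FP.fst.comp FP.fst))).pair
          ((FP.snd.comp FP.fst).pair FP.snd))

theorem PolyDec.onesCriterion (r : ℕ) {p q : α → ℕ} (hp : FP p) (hq : FP q)
    {E : α → ℕ → ℕ → ℚ} (hE : RatFP fun x : α × ℕ × ℕ => E x.1 x.2.1 x.2.2) :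
    PolyDec fun a => OnesCriterion r (p a) (q a) (E a) := by
  refine PolyDec.forall_tuple (P := fun a I => ∀ J : Fin r → ℕ, (∀ k, J k < q a) →
    (Matrix.of fun i b => (Fin.cons 1 fun k => E a (I i) (J k) : Fin (r + 1) → ℚ) b).det = 0) ?_ hp
  refine PolyDec.forall_tuple (P := fun (x : α × (Fin (r + 1) → ℕ)) J =>
    (Matrix.of fun i b => (Fin.cons 1 fun k => E x.1 (x.2 i) (J k) : Fin (r + 1) → ℚ) b).det = 0) ?_
    (hq.comp FP.fst)
  refine PolyDec.eq_zero (RatFP.det fun a b => ?_)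
  refine Fin.cases RatFP.one (fun k => ?_) b
  exact hE.comp ((FP.fst.comp FP.fst).pair
    ((FP.apply (FP.snd.comp FP.fst) a).pair (FP.apply FP.snd k)))

end PolynomialTime

/-! ### Minors and ranks -/

section Minors

variable {K : Type} [Field K] {m n : Type} [Fintype n]

/-- A basis of the span of a finite family of vectors can be chosen from the family. -/
theorem exists_finLinearIndependent {V : Type} [AddCommGroup V] [Module K V] (v : n → V) :
    ∃ (k : ℕ) (J : Fin k → n),
      Submodule.span K (Set.range fun i => v (J i)) = Submodule.span K (Set.range v) ∧
        LinearIndependent K fun i => v (J i) := by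
  obtain ⟨κ, a, ha, hs, hl⟩ := exists_linearIndependent' K v
  have : Finite κ := Finite.of_injective a ha
  have : Fintype κ := Fintype.ofFinite κ
  let e := (Fintype.equivFin κ).symm
  refine ⟨Fintype.card κ, fun i => a (e i), ?_, hl.comp e e.injective⟩
  rw [← hs]
  congr 1
  exact e.surjective.range_comp (v ∘ a)

theorem exists_rows_det_ne_zero [Fintype m] {k : ℕ} (N : Matrix m (Fin k) K) (h : LinearIndependent K N.col) :
    ∃ I : Fin k → m, (N.submatrix I id).det ≠ 0 := by
  obtain ⟨l, I, hs, hl⟩ := exists_finLinearIndependent (K := K) N.row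
  have h1 := finrank_span_eq_card hl
  rw [hs, ← rank_eq_finrank_span_row, rank_eq_finrank_span_cols, finrank_span_eq_card h,
    Fintype.card_fin, Fintype.card_fin] at h1
  subst h1
  refine ⟨I, ?_⟩
  have h2 : IsUnit (N.submatrix I id) := linearIndependent_rows_iff_isUnit.mp hl
  exact ((Matrix.isUnit_iff_isUnit_det _).mp h2).ne_zero

theorem le_rank_of_det_ne_zero {k : ℕ} (M : Matrix m n K) (I : Fin k → m) (J : Fin k → n)
    (h : (M.submatrix I J).det ≠ 0) : k ≤ M.rank := by
  have h1 := rank_submatrix_le M I J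
  rwa [rank_of_det_ne_zero h, Fintype.card_fin] at h1

theorem exists_minor_ne_zero [Fintype m] (M : Matrix m n K) :
    ∃ (I : Fin M.rank → m) (J : Fin M.rank → n), (M.submatrix I J).det ≠ 0 := by
  obtain ⟨k, J, hs, hl⟩ := exists_finLinearIndependent (K := K) M.col
  have h1 := finrank_span_eq_card hl
  rw [hs, ← rank_eq_finrank_span_cols, Fintype.card_fin] at h1
  subst h1
  obtain ⟨I, hI⟩ := exists_rows_det_ne_zero (M.submatrix id J) hl
  exact ⟨I, J, hI⟩

end Minors

theorem rank_map_cast {m n : Type} [Fintype m] [Fintype n] (M : Matrix m n ℚ) :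
    (M.map fun x : ℚ => (x : ℝ)).rank = M.rank := by
  have hdet : ∀ {k : ℕ} (I : Fin k → m) (J : Fin k → n),
      ((M.map fun x : ℚ => (x : ℝ)).submatrix I J).det = ((M.submatrix I J).det : ℝ) := by
    intro k I J
    exact ((algebraMap ℚ ℝ).map_det (M.submatrix I J)).symm
  apply le_antisymm
  · obtain ⟨I, J, h⟩ := exists_minor_ne_zero (M.map fun x : ℚ => (x : ℝ))
    rw [hdet] at h
    exact le_rank_of_det_ne_zero M I J (by exact_mod_cast h)
  · obtain ⟨I, J, h⟩ := exists_minor_ne_zero M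
    refine le_rank_of_det_ne_zero _ I J ?_
    rw [hdet]
    exact_mod_cast h

/-! ### The row cone generating condition in terms of minors -/

variable {p q : ℕ}

theorem rcgc_iff (M : Matrix (Fin p) (Fin q) ℝ) :
    RCGC M ↔ (∀ i j, 0 ≤ M i j) ∧
      ∀ y : Fin p → ℝ, 0 ≤ y ᵥ* M → ∃ z : Fin p → ℝ, 0 ≤ z ∧ z ᵥ* M = y ᵥ* M := by
  rw [RCGC, Set.ext_iff]
  constructor
  · intro h
    refine ⟨fun i j => ?_, fun y hy => (h (y ᵥ* M)).mpr ⟨⟨y, rfl⟩, hy⟩⟩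
    have := ((h (M.row i)).mp ⟨Pi.single i 1, Pi.single_nonneg.mpr zero_le_one,
      single_one_vecMul i M⟩).2
    exact this j
  · rintro ⟨h1, h2⟩ x
    constructor
    · rintro ⟨y, hy, rfl⟩
      exact ⟨⟨y, rfl⟩, fun j => (Finset.sum_nonneg fun i _ => mul_nonneg (hy i) (h1 i j) :
        0 ≤ ∑ i, y i * M i j)⟩
    · rintro ⟨⟨y, rfl⟩, hy⟩
      exact h2 y hy

/-- A functional that vanishes on a subspace, but not on a given vector. -/
theorem exists_dotProduct_ne_zero {m : Type} [Fintype m] [DecidableEq m]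
    {W : Submodule ℝ (m → ℝ)} {v : m → ℝ} (hv : v ∉ W) :
    ∃ y : m → ℝ, y ⬝ᵥ v ≠ 0 ∧ ∀ w ∈ W, y ⬝ᵥ w = 0 := by
  obtain ⟨f, hf, hW⟩ := Submodule.exists_le_ker_of_notMem hv
  have key : ∀ w, f w = (fun i => f (Pi.single i 1)) ⬝ᵥ w := by
    intro w
    conv_lhs => rw [pi_eq_sum_univ' w]
    rw [map_sum, dotProduct]
    refine Finset.sum_congr rfl fun i _ => ?_
    rw [map_smul, smul_eq_mul, mul_comm]
  exact ⟨_, by rwa [← key], fun w hw => by rw [← key]; exact hW hw⟩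

theorem dotProduct_eq_zero_of_mem_span {m ι : Type} [Fintype m] {v : ι → m → ℝ} {y w : m → ℝ}
    (hw : w ∈ Submodule.span ℝ (Set.range v)) (h : ∀ i, y ⬝ᵥ v i = 0) : y ⬝ᵥ w = 0 := by
  induction hw using Submodule.span_induction with
  | mem x hx => obtain ⟨i, rfl⟩ := hx; exact h i
  | zero => exact dotProduct_zero _
  | add a b _ _ ha hb => rw [dotProduct_add, ha, hb, add_zero]
  | smul c a _ ha => rw [dotProduct_smul, ha, smul_zero]

/-- The minors with rows `I` and columns `j, J`, for varying `j`, form a vector in the row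
span, by Laplace expansion. -/
theorem exists_vecMul_eq_det (M : Matrix (Fin p) (Fin q) ℝ) {s : ℕ} (I : Fin (s + 1) → Fin p)
    (J : Fin s → Fin q) :
    ∃ y : Fin p → ℝ, ∀ j, (y ᵥ* M) j = (M.submatrix I (Fin.cons j J : Fin (s + 1) → Fin q)).det := by
  refine ⟨∑ a : Fin (s + 1), Pi.single (I a)
    ((-1) ^ (a : ℕ) * (M.submatrix (fun b => I (a.succAbove b)) J).det), fun j => ?_⟩
  rw [det_succ_column_zero, Matrix.sum_vecMul, Finset.sum_apply]
  refine Finset.sum_congr rfl fun a _ => ?_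
  rw [single_vecMul]
  simp only [Pi.smul_apply, Matrix.row_apply, smul_eq_mul, submatrix_apply, Fin.cons_zero]
  have : (M.submatrix I (Fin.cons j J : Fin (s + 1) → Fin q)).submatrix a.succAbove Fin.succ =
      M.submatrix (fun b => I (a.succAbove b)) J := by
    ext b c
    simp
  rw [this]
  ring

theorem det_cons_self (M : Matrix (Fin p) (Fin q) ℝ) {s : ℕ} (I : Fin (s + 1) → Fin p)
    (J : Fin s → Fin q) (k : Fin s) :
    (M.submatrix I (Fin.cons (J k) J : Fin (s + 1) → Fin q)).det = 0 :=
  det_zero_of_column_eq (Fin.succ_ne_zero k).symm fun a => by simp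

/-- Subtracting from a nonnegative vector `x` the largest possible multiple of a vector `u` whose
support is contained in that of `x`. -/
theorem exists_sub_smul_nonneg {x u : Fin q → ℝ} (hx : 0 ≤ x) (hu : ∀ j, x j = 0 → u j = 0)
    (hpos : ∃ j, 0 < u j) :
    ∃ t : ℝ, 0 < t ∧ 0 ≤ x - t • u ∧ ∃ j, x j ≠ 0 ∧ (x - t • u) j = 0 := by
  obtain ⟨j, hj, hmin⟩ := Finset.exists_min_image (Finset.univ.filter fun j => 0 < u j)
    (fun j => x j / u j) (by simpa [Finset.filter_nonempty_iff] using hpos)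
  simp only [Finset.mem_filter, Finset.mem_univ, true_and] at hj hmin
  have hxj : 0 < x j := lt_of_le_of_ne (hx j) fun h => hj.ne' (hu j h.symm)
  refine ⟨x j / u j, div_pos hxj hj, fun i => ?_, j, hxj.ne', ?_⟩
  · simp only [Pi.zero_apply, Pi.sub_apply, Pi.smul_apply, smul_eq_mul, sub_nonneg]
    rcases le_or_gt (u i) 0 with h | h
    · exact (mul_nonpos_of_nonneg_of_nonpos (div_pos hxj hj).le h).trans (hx i)
    · have := hmin i h
      rwa [le_div_iff₀ h] at this
  · simp only [Pi.sub_apply, Pi.smul_apply, smul_eq_mul]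
    field_simp
    ring

/-- If every vector in the row span whose support is contained in that of `x` is a multiple of
`x`, then the criterion provides a row that spans the ray of `x`. -/
theorem exists_smul_row_eq {s : ℕ} {M : Matrix (Fin p) (Fin q) ℝ} (hrank : M.rank = s + 1)
    (h0 : ∀ i j, 0 ≤ M i j)
    (hM : ∀ (I : Fin (s + 1) → Fin p) (J : Fin s → Fin q),
      (∃ j, (M.submatrix I (Fin.cons j J : Fin (s + 1) → Fin q)).det ≠ 0) →
      ((∃ j, (M.submatrix I (Fin.cons j J : Fin (s + 1) → Fin q)).det < 0) ∧
        ∃ j, 0 < (M.submatrix I (Fin.cons j J : Fin (s + 1) → Fin q)).det) ∨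
        ∃ i, (∀ k, M i (J k) = 0) ∧ ∃ j, M i j ≠ 0)
    (y : Fin p → ℝ) (hy : 0 ≤ y ᵥ* M) (hy0 : y ᵥ* M ≠ 0)
    (hray : ∀ z : Fin p → ℝ, (∀ j, (y ᵥ* M) j = 0 → (z ᵥ* M) j = 0) →
      ∃ c : ℝ, z ᵥ* M = c • (y ᵥ* M)) :
    ∃ (i : Fin p) (c : ℝ), 0 ≤ c ∧ c • M.row i = y ᵥ* M := by
  classical
  set x := y ᵥ* M with hx
  have hcol : ∀ (z : Fin p → ℝ) j, (z ᵥ* M) j = z ⬝ᵥ M.col j := fun z j => rfl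
  -- `J` indexes a basis of the span of the columns in which `x` vanishes
  obtain ⟨n, J', hspan, hli⟩ := exists_finLinearIndependent (K := ℝ)
    (fun j : {j // x j = 0} => M.col j)
  set J : Fin n → Fin q := fun k => J' k with hJ
  have hzero : ∀ z : Fin p → ℝ, (∀ k, (z ᵥ* M) (J k) = 0) → ∀ j, x j = 0 → (z ᵥ* M) j = 0 := by
    intro z hz j hj
    have hmem : M.col j ∈ Submodule.span ℝ (Set.range fun k => M.col (J k)) := by
      rw [hspan]
      exact Submodule.subset_span ⟨⟨j, hj⟩, rfl⟩
    exact dotProduct_eq_zero_of_mem_span hmem fun k => hz k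
  obtain ⟨j₀, hj₀⟩ : ∃ j, x j ≠ 0 := by
    by_contra! h
    exact hy0 (funext h)
  have hli' : LinearIndependent ℝ (Fin.cons (M.col j₀) fun k => M.col (J k) :
      Fin (n + 1) → Fin p → ℝ) := by
    rw [linearIndependent_finCons]
    refine ⟨hli, fun hmem => hj₀ ?_⟩
    exact dotProduct_eq_zero_of_mem_span (y := y) hmem fun k => (J' k).2
  have hspan' : Submodule.span ℝ (Set.range (Fin.cons (M.col j₀) fun k => M.col (J k) :
      Fin (n + 1) → Fin p → ℝ)) = Submodule.span ℝ (Set.range M.col) := by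
    apply le_antisymm
    · apply Submodule.span_mono
      rintro _ ⟨k, rfl⟩
      exact Fin.cases ⟨j₀, rfl⟩ (fun k => ⟨J k, rfl⟩) k
    · rw [Submodule.span_le]
      rintro _ ⟨j, rfl⟩
      by_contra hmem
      obtain ⟨z, hz, hz'⟩ := exists_dotProduct_ne_zero hmem
      obtain ⟨c, hc⟩ := hray z (hzero z fun k => hz' _ (Submodule.subset_span ⟨k.succ, rfl⟩))
      have h1 : (z ᵥ* M) j₀ = 0 := hz' _ (Submodule.subset_span ⟨0, rfl⟩)
      rw [hc, Pi.smul_apply, smul_eq_mul, mul_eq_zero, or_iff_left hj₀] at h1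
      rw [h1, zero_smul] at hc
      exact hz (congrFun hc j)
  have hn := finrank_span_eq_card hli'
  rw [hspan', ← rank_eq_finrank_span_cols, hrank, Fintype.card_fin] at hn
  obtain rfl : s = n := by omega
  have hcols : (M.submatrix id (Fin.cons j₀ J : Fin (s + 1) → Fin q)).col =
      (Fin.cons (M.col j₀) fun k => M.col (J k) : Fin (s + 1) → Fin p → ℝ) := by
    funext k
    refine Fin.cases ?_ (fun k => ?_) k <;> rfl
  obtain ⟨I, hI⟩ := exists_rows_det_ne_zero (M.submatrix id (Fin.cons j₀ J : Fin (s + 1) → Fin q))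
    (by rw [hcols]; exact hli')
  rw [submatrix_submatrix, Function.comp_id, Function.id_comp] at hI
  rcases hM I J ⟨j₀, hI⟩ with ⟨⟨j, hj⟩, j', hj'⟩ | ⟨i, hi, j, hj⟩
  · -- the vector of minors is a multiple of `x`, so its entries do not have different signs
    exfalso
    obtain ⟨z, hz⟩ := exists_vecMul_eq_det M I J
    obtain ⟨c, hc⟩ := hray z (hzero z fun k => by rw [hz, det_cons_self])
    rw [← hz, hc, Pi.smul_apply, smul_eq_mul] at hj hj'
    have := hy j
    have := hy j'
    rcases le_or_gt 0 c with h | h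
    · exact hj.not_ge (mul_nonneg h (hy j))
    · exact hj'.not_ge (mul_nonpos_of_nonpos_of_nonneg h.le (hy j'))
  · have hrow : (Pi.single i 1 : Fin p → ℝ) ᵥ* M = M.row i := single_one_vecMul i M
    obtain ⟨c, hc⟩ := hray (Pi.single i 1) (hzero _ fun k => by rw [hrow]; exact hi k)
    rw [hrow] at hc
    have hcj : M i j = c * x j := congrFun hc j
    have hpos : 0 < c * x j := hcj ▸ lt_of_le_of_ne (h0 i j) (Ne.symm hj)
    have hcpos : 0 < c := pos_of_mul_pos_left hpos (hy j)
    exact ⟨i, c⁻¹, (inv_pos.mpr hcpos).le, by rw [hc, smul_smul, inv_mul_cancel₀ hcpos.ne', one_smul]⟩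

/-- The row cone generating condition, in terms of signs of minors. A set `J` of columns and a
set `I` of rows for which the minors `v j = det M[I, (j, J)]` do not all vanish determine a
vector `v` that spans the line of those vectors in the row span that vanish on `J`. If `v` or
`-v` is nonnegative, then it spans an extreme ray of the nonnegative part of the row span, so it
has to be a multiple of a row. -/
theorem rcgc_iff_minors {s : ℕ} {M : Matrix (Fin p) (Fin q) ℝ} (hrank : M.rank = s + 1) :
    RCGC M ↔ (∀ i j, 0 ≤ M i j) ∧ ∀ (I : Fin (s + 1) → Fin p) (J : Fin s → Fin q),
      (∃ j, (M.submatrix I (Fin.cons j J : Fin (s + 1) → Fin q)).det ≠ 0) →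
      ((∃ j, (M.submatrix I (Fin.cons j J : Fin (s + 1) → Fin q)).det < 0) ∧
        ∃ j, 0 < (M.submatrix I (Fin.cons j J : Fin (s + 1) → Fin q)).det) ∨
        ∃ i, (∀ k, M i (J k) = 0) ∧ ∃ j, M i j ≠ 0 := by
  rw [rcgc_iff]
  refine and_congr_right fun h0 => ⟨fun h I J hne => ?_, fun h => ?_⟩
  · by_contra! hcon
    obtain ⟨hsign, hrow⟩ := hcon
    obtain ⟨y, hy⟩ := exists_vecMul_eq_det M I J
    obtain ⟨j₀, hj₀⟩ := hne
    simp only [← hy] at hsign hj₀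
    -- some multiple of `y` yields a nonzero nonnegative vector that vanishes on `J`
    obtain ⟨z, hz, hz0, hzJ⟩ : ∃ z : Fin p → ℝ, 0 ≤ z ᵥ* M ∧ (z ᵥ* M) j₀ ≠ 0 ∧
        ∀ k, (z ᵥ* M) (J k) = 0 := by
      by_cases hneg : ∃ j, (y ᵥ* M) j < 0
      · refine ⟨-y, fun j => ?_, ?_, fun k => ?_⟩
        · rw [neg_vecMul]
          exact neg_nonneg.mpr (hsign hneg j)
        · rw [neg_vecMul]
          exact neg_ne_zero.mpr hj₀
        · rw [neg_vecMul, Pi.neg_apply, hy, det_cons_self, neg_zero]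
      · push Not at hneg
        exact ⟨y, hneg, hj₀, fun k => by rw [hy, det_cons_self]⟩
    obtain ⟨w, hw, hwz⟩ := h z hz
    rw [← hwz] at hz0 hzJ
    have hz0' : ∑ i, w i * M i j₀ ≠ 0 := hz0
    obtain ⟨i, -, hi⟩ := Finset.exists_ne_zero_of_sum_ne_zero hz0'
    have hwi : w i ≠ 0 := left_ne_zero_of_mul hi
    have hMi : M i j₀ ≠ 0 := right_ne_zero_of_mul hi
    refine hMi (hrow i (fun k => ?_) j₀)
    have hzJ' : ∑ i, w i * M i (J k) = 0 := hzJ k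
    have hsum := (Finset.sum_eq_zero_iff_of_nonneg
      fun i _ => mul_nonneg (hw i) (h0 i (J k))).mp hzJ' i (Finset.mem_univ i)
    exact (mul_eq_zero.mp hsum).resolve_left hwi
  · -- induction on the size of the support
    have key : ∀ (n : ℕ) (y : Fin p → ℝ), (Finset.univ.filter fun j => (y ᵥ* M) j ≠ 0).card = n →
        0 ≤ y ᵥ* M → ∃ z : Fin p → ℝ, 0 ≤ z ∧ z ᵥ* M = y ᵥ* M := by
      intro n
      induction n using Nat.strong_induction_on with
      | _ n ih =>
        intro y hn hy
        have hsmall : ∀ y' : Fin p → ℝ, 0 ≤ y' ᵥ* M →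
            (∀ j, (y ᵥ* M) j = 0 → (y' ᵥ* M) j = 0) →
            (∃ j, (y ᵥ* M) j ≠ 0 ∧ (y' ᵥ* M) j = 0) →
            ∃ z : Fin p → ℝ, 0 ≤ z ∧ z ᵥ* M = y' ᵥ* M := by
          rintro y' hy' hsupp ⟨j, hj, hj'⟩
          refine ih _ ?_ y' rfl hy'
          rw [← hn]
          refine Finset.card_lt_card ⟨fun i hi => ?_, fun hsub => ?_⟩
          · simp only [Finset.mem_filter, Finset.mem_univ, true_and] at hi ⊢
            exact fun h => hi (hsupp i h)
          · have := hsub (Finset.mem_filter.mpr ⟨Finset.mem_univ j, hj⟩)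
            exact (Finset.mem_filter.mp this).2 hj'
        by_cases hy0 : y ᵥ* M = 0
        · exact ⟨0, le_rfl, by rw [zero_vecMul, hy0]⟩
        by_cases hray : ∀ z : Fin p → ℝ, (∀ j, (y ᵥ* M) j = 0 → (z ᵥ* M) j = 0) →
            ∃ c : ℝ, z ᵥ* M = c • (y ᵥ* M)
        · obtain ⟨i, c, hc, hi⟩ := exists_smul_row_eq hrank h0 h y hy hy0 hray
          exact ⟨Pi.single i c, Pi.single_nonneg.mpr hc, by rw [single_vecMul, hi]⟩
        · push Not at hray
          -- decompose `y ᵥ* M` into two nonnegative vectors of smaller support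
          obtain ⟨u, hu, hne, hpos⟩ : ∃ u : Fin p → ℝ,
              (∀ j, (y ᵥ* M) j = 0 → (u ᵥ* M) j = 0) ∧ (∀ c : ℝ, u ᵥ* M ≠ c • (y ᵥ* M)) ∧
              ∃ j, 0 < (u ᵥ* M) j := by
            obtain ⟨u, hu, hne⟩ := hray
            by_cases hpos : ∃ j, 0 < (u ᵥ* M) j
            · exact ⟨u, hu, hne, hpos⟩
            · push Not at hpos
              refine ⟨-u, fun j hj => ?_, fun c hc => hne (-c) ?_, ?_⟩
              · rw [neg_vecMul, Pi.neg_apply, hu j hj, neg_zero]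
              · rw [neg_smul, ← hc, neg_vecMul, neg_neg]
              · by_contra! hcon
                refine hne 0 ?_
                rw [zero_smul]
                funext j
                have := hcon j
                rw [neg_vecMul, Pi.neg_apply, neg_nonpos] at this
                exact le_antisymm (hpos j) this
          obtain ⟨t, ht, hnn, j, hj, hj'⟩ := exists_sub_smul_nonneg hy hu hpos
          have e1 : y ᵥ* M - t • (u ᵥ* M) = (y - t • u) ᵥ* M := by
            rw [sub_vecMul, smul_vecMul]
          rw [e1] at hnn hj'
          have hs1 : ∀ j, (y ᵥ* M) j = 0 → ((y - t • u) ᵥ* M) j = 0 := by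
            intro j hj
            rw [← e1, Pi.sub_apply, Pi.smul_apply, hj, hu j hj, smul_zero, sub_zero]
          have hpos' : ∃ j, 0 < ((y - t • u) ᵥ* M) j := by
            by_contra! hcon
            have h0' : (y - t • u) ᵥ* M = 0 := le_antisymm hcon hnn
            rw [← e1, sub_eq_zero] at h0'
            exact hne t⁻¹ (by rw [h0', smul_smul, inv_mul_cancel₀ ht.ne', one_smul])
          obtain ⟨τ, hτ, hnn', i, hi, hi'⟩ := exists_sub_smul_nonneg hy hs1 hpos'
          have e2 : y ᵥ* M - τ • ((y - t • u) ᵥ* M) = (y - τ • (y - t • u)) ᵥ* M := by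
            rw [sub_vecMul M y (τ • (y - t • u)), smul_vecMul τ]
          rw [e2] at hnn' hi'
          obtain ⟨z₁, hz₁, hz₁'⟩ := hsmall _ hnn hs1 ⟨j, hj, hj'⟩
          obtain ⟨z₂, hz₂, hz₂'⟩ := hsmall _ hnn' (fun j hj => by
            rw [← e2, Pi.sub_apply, Pi.smul_apply, hj, hs1 j hj, smul_zero, sub_zero]) ⟨i, hi, hi'⟩
          refine ⟨z₂ + τ • z₁, add_nonneg hz₂ (smul_nonneg hτ.le hz₁), ?_⟩
          rw [add_vecMul, smul_vecMul, hz₁', hz₂', ← e2, sub_add_cancel]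
    exact fun y hy => key _ y rfl hy

/-- The all-ones vector is in the column span if and only if appending it to the matrix does
not increase the rank. -/
theorem exists_mulVec_eq_one_iff {r : ℕ} {M : Matrix (Fin p) (Fin q) ℝ} (hrank : M.rank = r) :
    (∃ y, M *ᵥ y = 1) ↔ ∀ (I : Fin (r + 1) → Fin p) (J : Fin r → Fin q),
      (Matrix.of fun a b => (Fin.cons 1 fun k => M (I a) (J k) : Fin (r + 1) → ℝ) b).det = 0 := by
  constructor
  · rintro ⟨y, hy⟩ I J
    by_contra hdet
    have hfac : (Matrix.of fun a b => (Fin.cons 1 fun k => M (I a) (J k) : Fin (r + 1) → ℝ) b) =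
        M.submatrix I id * Matrix.of fun j b =>
          (Fin.cons (y j) fun k => if j = J k then 1 else 0 : Fin (r + 1) → ℝ) b := by
      ext a b
      refine Fin.cases ?_ (fun k => ?_) b
      · have := congrFun hy (I a)
        simpa [mul_apply, mulVec, dotProduct] using this.symm
      · simp [mul_apply]
    have h1 := rank_of_det_ne_zero hdet
    rw [hfac, Fintype.card_fin] at h1
    have h2 := rank_mul_le_left (M.submatrix I id) (Matrix.of fun j b =>
          (Fin.cons (y j) fun k => if j = J k then 1 else 0 : Fin (r + 1) → ℝ) b)
    have h3 := rank_submatrix_le M I id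
    omega
  · intro h
    obtain ⟨n, J, hspan, hli⟩ := exists_finLinearIndependent (K := ℝ) M.col
    have hn := finrank_span_eq_card hli
    rw [hspan, ← rank_eq_finrank_span_cols, hrank, Fintype.card_fin] at hn
    subst hn
    by_contra hcon
    have hmem : (1 : Fin p → ℝ) ∉ Submodule.span ℝ (Set.range fun k => M.col (J k)) := by
      rw [hspan, ← Matrix.range_mulVecLin]
      exact fun ⟨y, hy⟩ => hcon ⟨y, hy⟩
    have hli' := linearIndependent_finCons.mpr ⟨hli, hmem⟩
    have hcols : (Matrix.of fun i b => (Fin.cons 1 fun k => M i (J k) : Fin (r + 1) → ℝ) b).col =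
        (Fin.cons 1 fun k => M.col (J k) : Fin (r + 1) → Fin p → ℝ) := by
      funext k
      refine Fin.cases ?_ (fun k => ?_) k <;> rfl
    obtain ⟨I, hI⟩ := exists_rows_det_ne_zero (Matrix.of fun i b =>
      (Fin.cons 1 fun k => M i (J k) : Fin (r + 1) → ℝ) b) (by rw [hcols]; exact hli')
    exact hI (h I J)

/-! ### Slack matrices and cone generating conditions -/

section Slack

variable {p q : ℕ}

theorem ccgc_iff_rcgc_transpose (M : Matrix (Fin p) (Fin q) ℝ) : CCGC M ↔ RCGC Mᵀ := by
  simp only [CCGC, RCGC, vecMul_transpose]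

/-- Coordinates on a subspace of `ℝ^q`, given by the matrix whose rows form a basis of it. -/
theorem exists_basis_matrix (L : Submodule ℝ (Fin q → ℝ)) :
    ∃ (n : ℕ) (B : Matrix (Fin n) (Fin q) ℝ), (∀ x y, x ᵥ* B = y ᵥ* B → x = y) ∧
      (∀ x, x ᵥ* B ∈ L) ∧ ∀ v ∈ L, ∃ x, x ᵥ* B = v := by
  let b := Module.finBasis ℝ L
  have key : ∀ x, x ᵥ* (Matrix.of fun k => (b k : Fin q → ℝ)) = b.equivFun.symm x := by
    intro x
    rw [vecMul_eq_sum, b.equivFun_symm_apply, Submodule.coe_sum]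
    rfl
  refine ⟨_, Matrix.of fun k => (b k : Fin q → ℝ), fun x y h => ?_, fun x => ?_, fun v hv => ?_⟩
  · rw [key, key] at h
    exact b.equivFun.symm.injective (Subtype.ext h)
  · rw [key]
    exact Subtype.prop _
  · exact ⟨b.equivFun ⟨v, hv⟩, by rw [key, LinearEquiv.symm_apply_apply]⟩

theorem isConeSlackMatrix_iff_rcgc (M : Matrix (Fin p) (Fin q) ℝ) :
    IsConeSlackMatrix M ↔ RCGC M := by
  constructor
  · rintro ⟨n, A, B, h, rfl⟩
    rw [Set.ext_iff] at h
    refine (rcgc_iff _).mpr ⟨fun i j => ?_, fun y hy => ?_⟩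
    · exact (h (A.row i)).mpr ⟨Pi.single i 1, Pi.single_nonneg.mpr zero_le_one,
        single_one_vecMul i A⟩ j
    · rw [← vecMul_vecMul] at hy
      obtain ⟨z, hz, hzy⟩ := (h (y ᵥ* A)).mp hy
      exact ⟨z, hz, by rw [← vecMul_vecMul, hzy, vecMul_vecMul]⟩
  · intro h
    obtain ⟨h0, h1⟩ := (rcgc_iff M).mp h
    obtain ⟨n, B, hinj, hmem, hsurj⟩ := exists_basis_matrix (LinearMap.range M.vecMulLinear)
    choose A hA using fun i => hsurj (M.row i) ⟨Pi.single i 1, single_one_vecMul i M⟩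
    have hM : M = Matrix.of A * B := by
      ext i j
      exact (congrFun (hA i) j).symm
    refine ⟨n, Matrix.of A, B, Set.ext fun x => ⟨fun hx => ?_, ?_⟩, hM⟩
    · obtain ⟨y, hy⟩ := hmem x
      have hy' : y ᵥ* M = x ᵥ* B := hy
      obtain ⟨z, hz, hzy⟩ := h1 y (by rw [hy']; exact hx)
      refine ⟨z, hz, hinj _ _ ?_⟩
      rw [vecMul_vecMul, ← hM, hzy, hy']
    · rintro ⟨y, hy, rfl⟩
      change 0 ≤ (y ᵥ* Matrix.of A) ᵥ* B
      rw [vecMul_vecMul, ← hM]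
      exact fun j => (Finset.sum_nonneg fun i _ => mul_nonneg (hy i) (h0 i j) :
        0 ≤ ∑ i, y i * M i j)

/-- The recession cone of a nonempty bounded polyhedron is trivial. -/
theorem eq_zero_of_mulVec_nonpos {n : ℕ} {W : Matrix (Fin q) (Fin n) ℝ} {w : Fin q → ℝ}
    (hbdd : Bornology.IsBounded {x | W *ᵥ x ≤ w}) {u : Fin n → ℝ} (hu : W *ᵥ u ≤ w)
    {x : Fin n → ℝ} (hx : W *ᵥ x ≤ 0) : x = 0 := by
  obtain ⟨C, hC⟩ := hbdd.exists_norm_le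
  by_contra hne
  have hpos : 0 < ‖x‖ := norm_pos_iff.mpr hne
  have hC0 : 0 ≤ C := (norm_nonneg u).trans (hC u hu)
  set t := (C + ‖u‖ + 1) / ‖x‖ with ht
  have ht0 : 0 ≤ t := by positivity
  have hmem : W *ᵥ (u + t • x) ≤ w := by
    rw [mulVec_add, mulVec_smul]
    exact (add_le_add hu (smul_nonpos_of_nonneg_of_nonpos ht0 hx)).trans (add_zero w).le
  have h1 := hC _ hmem
  have h2 : ‖t • x‖ = C + ‖u‖ + 1 := by
    rw [norm_smul, Real.norm_of_nonneg ht0, ht, div_mul_cancel₀ _ hpos.ne']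
  have h3 : ‖t • x‖ ≤ ‖u + t • x‖ + ‖u‖ := by
    have := norm_sub_le (u + t • x) u
    rwa [add_sub_cancel_left] at this
  linarith

theorem exists_weights_of_mem_convexHull {n : ℕ} {V : Matrix (Fin p) (Fin n) ℝ} {x : Fin n → ℝ}
    (hx : x ∈ convexHull ℝ (Set.range V.row)) :
    ∃ y : Fin p → ℝ, 0 ≤ y ∧ ∑ i, y i = 1 ∧ y ᵥ* V = x := by
  refine convexHull_min (t := {x | ∃ y : Fin p → ℝ, 0 ≤ y ∧ ∑ i, y i = 1 ∧ y ᵥ* V = x}) ?_ ?_ hx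
  · rintro _ ⟨i, rfl⟩
    exact ⟨Pi.single i 1, Pi.single_nonneg.mpr zero_le_one, by simp, single_one_vecMul i V⟩
  · rintro _ ⟨y, hy, hy1, rfl⟩ _ ⟨z, hz, hz1, rfl⟩ a b ha hb hab
    refine ⟨a • y + b • z, add_nonneg (smul_nonneg ha hy) (smul_nonneg hb hz), ?_, ?_⟩
    · simp [Finset.sum_add_distrib, ← Finset.mul_sum, hy1, hz1, hab]
    · rw [add_vecMul, smul_vecMul, smul_vecMul]

/-- The homogenization of a polytope of positive dimension is generated by the lifted vertices.
The dimension enters as follows: if the polytope is a single point, its homogenization may contain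
the whole line through the lifted point. -/
theorem homogenization_eq {n : ℕ} {V : Matrix (Fin p) (Fin n) ℝ} {W : Matrix (Fin q) (Fin n) ℝ}
    {w : Fin q → ℝ} (hP : convexHull ℝ (Set.range V.row) = {x | W *ᵥ x ≤ w})
    {i i' : Fin p} (hne : V i ≠ V i') {t : ℝ} {x : Fin n → ℝ} (hx : W *ᵥ x ≤ t • w) :
    ∃ y : Fin p → ℝ, 0 ≤ y ∧ ∑ i, y i = t ∧ y ᵥ* V = x := by
  have hV : ∀ i, W *ᵥ V i ≤ w := fun i => by
    have : V i ∈ convexHull ℝ (Set.range V.row) := subset_convexHull ℝ _ ⟨i, rfl⟩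
    rwa [hP] at this
  have hbdd : Bornology.IsBounded {x | W *ᵥ x ≤ w} := by
    rw [← hP]
    exact isBounded_convexHull.mpr (Set.finite_range _).isBounded
  rcases lt_trichotomy t 0 with ht | rfl | ht
  · -- adding a positive multiple of `x` would move every point of the polytope to the origin
    exfalso
    have hmove : ∀ k, V k + (-t)⁻¹ • x = 0 := by
      intro k
      refine eq_zero_of_mulVec_nonpos hbdd (hV i) ?_
      have h1 : (-t)⁻¹ • (W *ᵥ x) ≤ (-t)⁻¹ • t • w :=
        smul_le_smul_of_nonneg_left hx (inv_pos.mpr (neg_pos.mpr ht)).le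
      have h2 : (-t)⁻¹ * t = -1 := by
        rw [inv_neg, neg_mul, inv_mul_cancel₀ ht.ne]
      rw [smul_smul, h2, neg_smul, one_smul] at h1
      rw [mulVec_add, mulVec_smul]
      exact (add_le_add (hV k) h1).trans (add_neg_cancel w).le
    exact hne (add_right_cancel ((hmove i).trans (hmove i').symm))
  · rw [zero_smul] at hx
    refine ⟨0, le_rfl, by simp, ?_⟩
    rw [zero_vecMul, eq_zero_of_mulVec_nonpos hbdd (hV i) hx]
  · have hmem : t⁻¹ • x ∈ convexHull ℝ (Set.range V.row) := by
      rw [hP]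
      change W *ᵥ (t⁻¹ • x) ≤ w
      rw [mulVec_smul]
      have h1 : t⁻¹ • (W *ᵥ x) ≤ t⁻¹ • t • w :=
        smul_le_smul_of_nonneg_left hx (inv_pos.mpr ht).le
      rwa [smul_smul, inv_mul_cancel₀ ht.ne', one_smul] at h1
    obtain ⟨y, hy, hy1, hyx⟩ := exists_weights_of_mem_convexHull hmem
    refine ⟨t • y, smul_nonneg ht.le hy, ?_, ?_⟩
    · simp [← Finset.mul_sum, hy1]
    · rw [smul_vecMul, hyx, smul_smul, mul_inv_cancel₀ ht.ne', one_smul]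

/-- In a polytope slack matrix, the vector `𝟙` is in the column span: a linear relation between
the rows of `M = [𝟙, V] · [w, -W]ᵀ` is one between the rows of `[𝟙, V]`. Conversely, if
`M y = 𝟙`, then `y` provides the hyperplane by which the cone over the rows of `M` has to be cut. -/
theorem isPolytopeSlackMatrix_iff (M : Matrix (Fin p) (Fin q) ℝ) :
    IsPolytopeSlackMatrix M ↔ RCGC M ∧ (∃ y, M *ᵥ y = 1) ∧ ∃ i i', M i ≠ M i' := by
  constructor
  · rintro ⟨n, V, W, w, hP, hdim, hM⟩
    obtain ⟨i, i', hne⟩ : ∃ i i', V i ≠ V i' := by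
      by_contra! hcon
      have hsub : (convexHull ℝ (Set.range V.row)).Subsingleton := by
        rcases Set.Subsingleton.eq_empty_or_singleton (s := Set.range V.row) (by
          rintro _ ⟨i, rfl⟩ _ ⟨i', rfl⟩
          exact hcon i i') with h | ⟨x, h⟩ <;> rw [h] <;> simp
      rw [vectorSpan_of_subsingleton ℝ hsub, finrank_bot] at hdim
      omega
    have hhom := fun t x => homogenization_eq (t := t) (x := x) hP hne
    have hMV : ∀ y : Fin p → ℝ, y ᵥ* M = (∑ i, y i) • w - W *ᵥ (y ᵥ* V) := by
      intro y
      rw [hM]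
      funext j
      simp only [vecMul, dotProduct, of_apply, mul_sub, Finset.sum_sub_distrib, Pi.sub_apply,
        Pi.smul_apply, smul_eq_mul, Finset.sum_mul, mulVec, Finset.mul_sum]
      rw [Finset.sum_comm]
      congr 1
      refine Finset.sum_congr rfl fun k _ => Finset.sum_congr rfl fun i _ => by ring
    have hinj : ∀ y : Fin p → ℝ, y ᵥ* M = 0 → ∑ i, y i = 0 ∧ y ᵥ* V = 0 := by
      intro y hy
      rw [hMV, sub_eq_zero] at hy
      obtain ⟨z, hz, hz1, hz2⟩ := hhom _ _ hy.ge
      obtain ⟨z', hz', hz1', hz2'⟩ := hhom (-∑ i, y i) (-(y ᵥ* V)) (by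
        rw [mulVec_neg, neg_smul, hy])
      have e1 : 0 ≤ ∑ i, z i := Finset.sum_nonneg fun i _ => hz i
      have e2 : 0 ≤ ∑ i, z' i := Finset.sum_nonneg fun i _ => hz' i
      have e3 : ∑ i, z i = 0 := by linarith
      have e4 : z = 0 := funext fun i =>
        (Finset.sum_eq_zero_iff_of_nonneg fun i _ => hz i).mp e3 i (Finset.mem_univ i)
      exact ⟨hz1 ▸ e3, by rw [← hz2, e4, zero_vecMul]⟩
    refine ⟨(rcgc_iff M).mpr ⟨fun k j => ?_, fun y hy => ?_⟩, ?_, i, i', fun hrow => ?_⟩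
    · have h1 : V k ∈ convexHull ℝ (Set.range V.row) := subset_convexHull ℝ _ ⟨k, rfl⟩
      rw [hP] at h1
      rw [hM]
      exact sub_nonneg.mpr (h1 j)
    · rw [hMV, sub_nonneg] at hy
      obtain ⟨z, hz, hz1, hz2⟩ := hhom _ _ hy
      exact ⟨z, hz, by rw [hMV, hMV, hz1, hz2]⟩
    · by_contra hcon
      obtain ⟨y, hy, hy'⟩ := exists_dotProduct_ne_zero (W := LinearMap.range M.mulVecLin)
        (v := 1) fun ⟨y, hy⟩ => hcon ⟨y, hy⟩
      refine hy ?_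
      rw [dotProduct_one]
      refine (hinj y (funext fun j => ?_)).1
      exact hy' (M.col j) ⟨Pi.single j 1, mulVec_single_one M j⟩
    · have h1 : (Pi.single i 1 - Pi.single i' 1 : Fin p → ℝ) ᵥ* M = 0 := by
        rw [sub_vecMul, single_one_vecMul, single_one_vecMul, sub_eq_zero]
        exact hrow
      have h2 := (hinj _ h1).2
      rw [sub_vecMul, single_one_vecMul, single_one_vecMul, sub_eq_zero] at h2
      exact hne h2
  · rintro ⟨hR, ⟨y, hy⟩, i₀, i₁, hne⟩
    obtain ⟨h0, h1⟩ := (rcgc_iff M).mp hR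
    have hsum : ∀ z : Fin p → ℝ, (z ᵥ* M) ⬝ᵥ y = ∑ i, z i := by
      intro z
      rw [← dotProduct_mulVec, hy, dotProduct_one]
    obtain ⟨n, B, hinj, hmem, hsurj⟩ := exists_basis_matrix
      (Submodule.map M.vecMulLinear (LinearMap.ker (Fintype.linearCombination ℝ (1 : Fin p → ℝ))))
    have hmem' : ∀ x, ∃ z : Fin p → ℝ, ∑ i, z i = 0 ∧ z ᵥ* M = x ᵥ* B := by
      intro x
      obtain ⟨z, hz, hzx⟩ := hmem x
      exact ⟨z, by simpa [Fintype.linearCombination_apply] using hz, hzx⟩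
    choose V hV using fun i => hsurj (M i - M i₀) ⟨Pi.single i 1 - Pi.single i₀ 1,
      by simp [Fintype.linearCombination_apply], by
        change (Pi.single i 1 - Pi.single i₀ 1 : Fin p → ℝ) ᵥ* M = _
        rw [sub_vecMul, single_one_vecMul, single_one_vecMul]
        rfl⟩
    have hW : ∀ x, (-Bᵀ) *ᵥ x = -(x ᵥ* B) := fun x => by
      rw [neg_mulVec, mulVec_transpose]
    refine ⟨n, Matrix.of V, -Bᵀ, M i₀, Set.Subset.antisymm ?_ ?_, ?_, ?_⟩
    · refine convexHull_min ?_ ?_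
      · rintro _ ⟨i, rfl⟩ j
        change ((-Bᵀ) *ᵥ V i) j ≤ M i₀ j
        rw [hW, hV, neg_sub, Pi.sub_apply]
        linarith [h0 i j]
      · intro a ha b hb s t hs ht hst
        change (-Bᵀ) *ᵥ (s • a + t • b) ≤ M i₀
        rw [mulVec_add, mulVec_smul, mulVec_smul]
        refine (add_le_add (smul_le_smul_of_nonneg_left ha hs)
          (smul_le_smul_of_nonneg_left hb ht)).trans ?_
        rw [← add_smul, hst, one_smul]
    · intro x hx
      have hx' : (-Bᵀ) *ᵥ x ≤ M i₀ := hx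
      rw [hW, neg_le_iff_add_nonneg] at hx'
      obtain ⟨z, hz, hzx⟩ := hmem' x
      have e1 : (z + Pi.single i₀ 1) ᵥ* M = M i₀ + x ᵥ* B := by
        rw [add_vecMul, hzx, single_one_vecMul, add_comm]
        rfl
      obtain ⟨c, hc, hcx⟩ := h1 (z + Pi.single i₀ 1) (by rw [e1]; exact hx')
      have hc1 : ∑ i, c i = 1 := by
        rw [← hsum, hcx, hsum]
        simp [Finset.sum_add_distrib, hz]
      refine mem_convexHull_of_exists_fintype c V hc hc1 (fun i => ⟨i, rfl⟩) (hinj _ _ ?_)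
      rw [Matrix.sum_vecMul]
      simp only [smul_vecMul, hV, smul_sub, Finset.sum_sub_distrib]
      rw [← Finset.sum_smul, hc1, one_smul, sub_eq_iff_eq_add', ← e1, ← hcx, vecMul_eq_sum]
    · rw [Nat.one_le_iff_ne_zero, ne_eq, Submodule.finrank_eq_zero]
      intro hbot
      have hmemV : ∀ i, V i ∈ convexHull ℝ (Set.range (Matrix.of V).row) := fun i =>
        subset_convexHull ℝ _ ⟨i, rfl⟩
      have := vsub_mem_vectorSpan ℝ (hmemV i₀) (hmemV i₁)
      rw [hbot, Submodule.mem_bot, vsub_eq_sub, sub_eq_zero] at this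
      have e := hV i₁
      rw [← this, hV i₀] at e
      exact hne (sub_left_injective e)
    · ext i j
      have e := congrFun (hV i) j
      have e2 : (-Bᵀ) j ⬝ᵥ V i = -((V i ᵥ* B) j) := congrFun (hW (V i)) j
      change M i j = M i₀ j - (-Bᵀ) j ⬝ᵥ V i
      rw [e2, e, Pi.sub_apply]
      ring

end Slack

/-! ### The four decision problems -/

theorem forall_lt_iff_forall_fin {n : ℕ} {P : ℕ → Prop} : (∀ i < n, P i) ↔ ∀ i : Fin n, P i :=
  ⟨fun h i => h i i.2, fun h i hi => h ⟨i, hi⟩⟩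

theorem exists_lt_iff_exists_fin {n : ℕ} {P : ℕ → Prop} : (∃ i < n, P i) ↔ ∃ i : Fin n, P i :=
  ⟨fun ⟨i, hi, h⟩ => ⟨⟨i, hi⟩, h⟩, fun ⟨i, h⟩ => ⟨i, i.2, h⟩⟩

theorem forall_tuple_lt_iff {k n : ℕ} {P : (Fin k → ℕ) → Prop} :
    (∀ I : Fin k → ℕ, (∀ a, I a < n) → P I) ↔ ∀ I : Fin k → Fin n, P fun a => I a :=
  ⟨fun h I => h _ fun a => (I a).2, fun h I hI => h fun a => ⟨I a, hI a⟩⟩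

section Criteria

variable {p q : ℕ} {M : Matrix (Fin p) (Fin q) ℚ} {E : ℕ → ℕ → ℚ}

theorem rowCriterion_iff {s : ℕ} (hrank : M.rank = s + 1)
    (hE : ∀ (i : Fin p) (j : Fin q), E i j = M i j) :
    RowCriterion s p q E ↔ RCGC (M.map fun x : ℚ => (x : ℝ)) := by
  have hdet : ∀ (I : Fin (s + 1) → Fin p) (J : Fin s → Fin q) (j : Fin q),
      ((M.map fun x : ℚ => (x : ℝ)).submatrix I (Fin.cons j J : Fin (s + 1) → Fin q)).det =
        ((bordered E (fun a => I a) (fun k => J k) j).det : ℝ) := by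
    intro I J j
    refine Eq.trans ?_ ((algebraMap ℚ ℝ).map_det _).symm
    congr 1
    ext a b
    refine Fin.cases ?_ (fun k => ?_) b <;> simp [bordered, hE]
  rw [rcgc_iff_minors ((rank_map_cast M).trans hrank)]
  simp only [RowCriterion, hdet, forall_lt_iff_forall_fin, exists_lt_iff_exists_fin,
    forall_tuple_lt_iff, hE, Matrix.map_apply, Rat.cast_nonneg, Rat.cast_pos, Rat.cast_lt_zero,
    Rat.cast_eq_zero, ne_eq]

theorem onesCriterion_iff {r : ℕ} (hrank : M.rank = r)
    (hE : ∀ (i : Fin p) (j : Fin q), E i j = M i j) :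
    OnesCriterion r p q E ↔ ∃ y, (M.map fun x : ℚ => (x : ℝ)) *ᵥ y = 1 := by
  have hdet : ∀ (I : Fin (r + 1) → Fin p) (J : Fin r → Fin q),
      (Matrix.of fun a b => (Fin.cons 1 fun k => (M.map fun x : ℚ => (x : ℝ)) (I a) (J k) :
        Fin (r + 1) → ℝ) b).det =
        ((Matrix.of fun a b => (Fin.cons 1 fun k => E (I a) (J k) :
          Fin (r + 1) → ℚ) b).det : ℝ) := by
    intro I J
    refine Eq.trans ?_ ((algebraMap ℚ ℝ).map_det _).symm
    congr 1
    ext a b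
    refine Fin.cases ?_ (fun k => ?_) b <;> simp [hE]
  rw [exists_mulVec_eq_one_iff ((rank_map_cast M).trans hrank)]
  simp only [OnesCriterion, hdet, forall_tuple_lt_iff, Rat.cast_eq_zero]

theorem exists_ne_row_iff (hE : ∀ (i : Fin p) (j : Fin q), E i j = M i j) :
    (∃ i < p, ∃ i' < p, ∃ j < q, E i j + -E i' j ≠ 0) ↔
      ∃ i i', (M.map fun x : ℚ => (x : ℝ)) i ≠ (M.map fun x : ℚ => (x : ℝ)) i' := by
  simp only [exists_lt_iff_exists_fin, hE, Function.ne_iff, Matrix.map_apply, ne_eq, Rat.cast_inj,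
    ← sub_eq_add_neg, sub_eq_zero]

end Criteria

variable {r : ℕ}

theorem readEntry_code (M : RankMatrix r) (i : Fin M.p) (j : Fin M.q) :
    readEntry M.code i j = M.mat i j :=
  readEntry_matrixCode M.mat i j

theorem ratFP_readEntry :
    RatFP fun x : List Γ' × ℕ × ℕ => readEntry x.1 x.2.1 x.2.2 :=
  RatFP.readEntry FP.fst (FP.fst.comp FP.snd) (FP.snd.comp FP.snd)

theorem rowCriterion_code_iff {s : ℕ} (M : RankMatrix (s + 1)) :
    RowCriterion s (numRows M.code) (numCols M.code) (readEntry M.code) ↔ RCGC M.toReal := by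
  rw [RankMatrix.code, numRows_matrixCode, numCols_matrixCode]
  exact rowCriterion_iff M.rank_eq (readEntry_code M)

theorem rowCriterion_code_iff_ccgc {s : ℕ} (M : RankMatrix (s + 1)) :
    RowCriterion s (numCols M.code) (numRows M.code) (fun i j => readEntry M.code j i) ↔
      CCGC M.toReal := by
  rw [RankMatrix.code, numRows_matrixCode, numCols_matrixCode, ccgc_iff_rcgc_transpose]
  exact rowCriterion_iff (M := M.matᵀ) ((rank_transpose _).trans M.rank_eq)
    fun i j => readEntry_code M j i

theorem toReal_eq_zero (M : RankMatrix 0) : M.toReal = 0 := by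
  have h := M.rank_eq
  rw [Matrix.rank, Submodule.finrank_eq_zero, LinearMap.range_eq_bot] at h
  have h' : M.mat = 0 := by
    rw [← Matrix.toLin'_apply', LinearEquiv.map_eq_zero_iff] at h
    exact h
  ext i j
  simp [RankMatrix.toReal, h']

/-- The row criterion needs positive rank; matrices of rank zero are treated separately. -/
theorem rcgc_zero {p q : ℕ} : RCGC (0 : Matrix (Fin p) (Fin q) ℝ) :=
  (rcgc_iff _).mpr ⟨fun _ _ => le_rfl, fun y _ => ⟨0, le_rfl, by rw [vecMul_zero, vecMul_zero]⟩⟩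

theorem not_isPolytopeSlackMatrix_zero {p q : ℕ} :
    ¬ IsPolytopeSlackMatrix (0 : Matrix (Fin p) (Fin q) ℝ) := by
  rw [isPolytopeSlackMatrix_iff]
  rintro ⟨-, -, i, i', h⟩
  exact h rfl

theorem decidable_rcgc :
    DecidableInPolyTime (RankMatrix.code (r := r)) fun M => RCGC M.toReal := by
  rcases r with _ | s
  · refine .of_polyDec (PolyDec.const True) fun M => ?_
    simp only [toReal_eq_zero, rcgc_zero]
  · exact .of_polyDec (PolyDec.rowCriterion s FP.numRows FP.numCols ratFP_readEntry)
      rowCriterion_code_iff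

theorem decidable_ccgc :
    DecidableInPolyTime (RankMatrix.code (r := r)) fun M => CCGC M.toReal := by
  rcases r with _ | s
  · refine .of_polyDec (PolyDec.const True) fun M => ?_
    simp only [toReal_eq_zero, ccgc_iff_rcgc_transpose, transpose_zero, rcgc_zero]
  · exact .of_polyDec (PolyDec.rowCriterion (E := fun w i j => readEntry w j i) s FP.numCols
      FP.numRows (ratFP_readEntry.comp
        (FP.fst.pair ((FP.snd.comp FP.snd).pair (FP.fst.comp FP.snd))))) rowCriterion_code_iff_ccgc

theorem decidable_isPolytopeSlackMatrix :
    DecidableInPolyTime (RankMatrix.code (r := r)) fun M => IsPolytopeSlackMatrix M.toReal := by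
  rcases r with _ | s
  · refine .of_polyDec (PolyDec.const False) fun M => ?_
    simp only [toReal_eq_zero, not_isPolytopeSlackMatrix_zero]
  · have hne : PolyDec fun w => ∃ i < numRows w, ∃ i' < numRows w, ∃ j < numCols w,
        readEntry w i j + -readEntry w i' j ≠ 0 := by
      refine PolyDec.exists_lt (P := fun w i => ∃ i' < numRows w, ∃ j < numCols w,
        readEntry w i j + -readEntry w i' j ≠ 0) ?_ FP.numRows
      refine PolyDec.exists_lt (P := fun (x : List Γ' × ℕ) i' => ∃ j < numCols x.1,
        readEntry x.1 x.2 j + -readEntry x.1 i' j ≠ 0) ?_ (FP.numRows.comp FP.fst)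
      refine PolyDec.exists_lt (P := fun (x : (List Γ' × ℕ) × ℕ) j =>
        readEntry x.1.1 x.1.2 j + -readEntry x.1.1 x.2 j ≠ 0) ?_
        (FP.numCols.comp (FP.fst.comp FP.fst))
      have hw : FP fun x : ((List Γ' × ℕ) × ℕ) × ℕ => x.1.1.1 :=
        FP.fst.comp (FP.fst.comp FP.fst)
      exact (PolyDec.eq_zero (RatFP.add
        (RatFP.readEntry hw (FP.snd.comp (FP.fst.comp FP.fst)) FP.snd)
        (RatFP.readEntry hw (FP.snd.comp FP.fst) FP.snd).neg)).not
    refine .of_polyDec ((PolyDec.rowCriterion s FP.numRows FP.numCols ratFP_readEntry).and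
      ((PolyDec.onesCriterion (s + 1) FP.numRows FP.numCols ratFP_readEntry).and hne)) fun M => ?_
    rw [isPolytopeSlackMatrix_iff, rowCriterion_code_iff]
    refine and_congr_right fun _ => ?_
    rw [RankMatrix.code, numRows_matrixCode, numCols_matrixCode]
    exact and_congr (onesCriterion_iff M.rank_eq (readEntry_code M))
      (exists_ne_row_iff (readEntry_code M))

end SlackMatrix

theorem theorem3p2 (r : ℕ) :
    SlackMatrix.DecidableInPolyTime (SlackMatrix.RankMatrix.code (r := r))
        (fun M => SlackMatrix.RCGC M.toReal) ∧
      SlackMatrix.DecidableInPolyTime (SlackMatrix.RankMatrix.code (r := r))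
        (fun M => SlackMatrix.CCGC M.toReal) ∧
      SlackMatrix.DecidableInPolyTime (SlackMatrix.RankMatrix.code (r := r))
        (fun M => SlackMatrix.IsConeSlackMatrix M.toReal) ∧
      SlackMatrix.DecidableInPolyTime (SlackMatrix.RankMatrix.code (r := r))
        (fun M => SlackMatrix.IsPolytopeSlackMatrix M.toReal) := by
  refine ⟨SlackMatrix.decidable_rcgc, SlackMatrix.decidable_ccgc, ?_,
    SlackMatrix.decidable_isPolytopeSlackMatrix⟩
  simp only [SlackMatrix.isConeSlackMatrix_iff_rcgc]
  exact SlackMatrix.decidable_rcgc
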